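/- Let $X$ be a separable real Banach space and let $\Phi,\Psi:X\to[0,\infty)$ be continuous functions with $\Psi(0)=0$. For a step function $f=\sum_{k=1}^N x_k\mathbf 1_{A_k}:[-\pi,\pi)\to X$ (finitely many intervals $A_k$, $x_k\in X$) let $$\mathcal H^{\mathbb T}_Xf(t)=\frac1{2\pi}\,\mathrm{p.v.}\!\int_{-\pi}^{\pi}f(s)\cot\frac{t-s}{2}\,ds$$ be its periodic Hilbert transform (defined for all but finitely many $t$), and put $$|\mathcal H^{\mathbb T}_X|_{\Phi,\Psi}:=\inf\Bigl\{c\in[0,\infty]:\int_{-\pi}^{\pi}\Psi(\mathcal H^{\mathbb T}_Xf(s))\,ds\le c\int_{-\pi}^{\pi}\Phi(f(s))\,ds\ \text{ for all step functions } f\Bigr\}.$$ Assume $|\mathcal H^{\mathbb T}_X|_{\Phi,\Psi}<\infty$. Then there is a plurisubharmonic function $U:X+iX\to\mathbb R\cup\{-\infty\}$ (that is, $U$ is upper semicontinuous and $z\mapsto U(p+zv)$ is subharmonic on $\mathbb C$ for all $p,v\in X+iX$) such that $U(x)\ge 0$ for all $x\in X$ and $$U(x+iy)\le |\mathcal H^{\mathbb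 T}_X|_{\Phi,\Psi}\,\Phi(x)-\Psi(y),\qquad x,y\in X.$$ Moreover, if $\Psi$ is convex, then this $U$ is real-valued (nowhere $-\infty$) and $y\mapsto U(x+iy)$ is concave on $X$ for every $x\in X$. -/

import Mathlib

open Set Filter Topology MeasureTheory
open scoped ENNReal

namespace HilbertPSH

noncomputable section

/-- The fundamental domain `[-π, π)` of the torus `𝕋`. -/
def torus : Set ℝ := Ico (-Real.pi) Real.pi

/-- Step functions `f = ∑ₖ xₖ 1_{Aₖ}` on the torus, with finitely many intervals `Aₖ ⊆ [-π, π)`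
(of any type: open, closed, half-open, degenerate, not necessarily disjoint).  They are
realised as functions on `ℝ` vanishing outside `[-π, π)`. -/
def IsStep {X : Type*} [AddCommGroup X] (f : ℝ → X) : Prop :=
  ∃ (N : ℕ) (x : Fin N → X) (A : Fin N → Set ℝ),
    (∀ k, (A k).OrdConnected ∧ A k ⊆ torus) ∧
      f = fun s => ∑ k, (A k).indicator (fun _ => x k) s

/-- The truncated integral `∫_{s ∈ [-π,π), |t-s| > ε} cot((t-s)/2) f(s) ds`. -/
def truncHilbert {X : Type*} [NormedAddCommGroup X] [NormedSpace ℝ X]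
    (f : ℝ → X) (ε t : ℝ) : X :=
  ∫ s in torus ∩ {s : ℝ | ε < |t - s|}, Real.cot ((t - s) / 2) • f s

/-- The periodic Hilbert transform `(1/2π) p.v. ∫_{-π}^{π} f(s) cot((t-s)/2) ds`.  For a step
function the principal value exists at all but finitely many points of `[-π, π)` (the end
points of the intervals); the value at these is irrelevant. -/
def periodicHilbert {X : Type*} [NormedAddCommGroup X] [NormedSpace ℝ X]
    (f : ℝ → X) (t : ℝ) : X :=
  (1 / (2 * Real.pi)) • limUnder (𝓝[>] (0 : ℝ)) (fun ε => truncHilbert f ε t)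

/-- The `Φ,Ψ`-norm of the periodic Hilbert transform: the infimum of all `c ∈ [0, ∞]` with
`∫_𝕋 Ψ(Hf) ≤ c ∫_𝕋 Φ(f)` for all step functions `f`. -/
def hilbertNorm {X : Type*} [NormedAddCommGroup X] [NormedSpace ℝ X] (Φ Ψ : X → ℝ) : ℝ≥0∞ :=
  sInf {c : ℝ≥0∞ | ∀ f : ℝ → X, IsStep f →
    ∫⁻ s in torus, ENNReal.ofReal (Ψ (periodicHilbert f s))
      ≤ c * ∫⁻ s in torus, ENNReal.ofReal (Φ (f s))}

/-- Subharmonic functions `ℂ → ℝ ∪ {-∞}`: upper semicontinuous, and dominated on every disc by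
each harmonic function that dominates them on the boundary circle. -/
def Subharmonic (f : ℂ → EReal) : Prop :=
  (∀ z, f z ≠ ⊤) ∧ UpperSemicontinuous f ∧
    ∀ (c : ℂ) (r : ℝ), 0 < r → ∀ g : ℂ → ℝ,
      ContinuousOn g (Metric.closedBall c r) →
      InnerProductSpace.HarmonicOnNhd g (Metric.ball c r) →
      (∀ z ∈ Metric.sphere c r, f z ≤ (g z : EReal)) →
      ∀ z ∈ Metric.ball c r, f z ≤ (g z : EReal)

/-- Multiplication by complex scalars in the complexification `X + iX`, where `x + iy` is
encoded as the pair `(x, y)`: `(a + ib)(x + iy) = (ax - by) + i(ay + bx)`. -/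
def complexSMul {X : Type*} [AddCommGroup X] [Module ℝ X] (z : ℂ) (v : X × X) : X × X :=
  (z.re • v.1 - z.im • v.2, z.re • v.2 + z.im • v.1)

/-- Plurisubharmonic functions `X + iX → ℝ ∪ {-∞}`: upper semicontinuous, and subharmonic
along every complex line `z ↦ p + z v`. -/
def Plurisubharmonic {X : Type*} [NormedAddCommGroup X] [NormedSpace ℝ X]
    (F : X × X → EReal) : Prop :=
  (∀ p, F p ≠ ⊤) ∧ UpperSemicontinuous F ∧
    ∀ p v : X × X, Subharmonic fun z : ℂ => F (p + complexSMul z v)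

end

end HilbertPSH

namespace HilbertPSH

noncomputable section

/-! Let c be the norm and V(x + iy) = c Φ(x) - Ψ(y). The function U is the Poletsky-type disc
envelope of V: at p it is the infimum, over polynomial analytic discs centred at p, of the mean of V
on the boundary circle. The constant disc gives U ≤ V, and U is upper semicontinuous as an infimum
of continuous functions.

Plurisubharmonicity is a gluing argument (`discEnvelope_le_integral`). Near-optimal discs centred at
the points p + e^{iθ}v can be chosen from a finite family, with the choice measurable in θ. The
indicators of this choice are approximated by trigonometric polynomials T_i, and e^{iθ}v + ∑ T_i(θ)
F_i(nθ + α) is again an analytic polynomial for large n. Averaging over α makes the two angles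
independent, which yields the sub-mean value inequality; a maximum principle
(`SubMean.le_of_le_frontier`) turns it into domination by harmonic majorants.

U ≥ 0 on X is where the Hilbert transform enters. On the boundary of a disc centred at a real point,
the imaginary part is the conjugate of the real part, so the Φ,Ψ-inequality says exactly that V has
nonnegative mean (`discMean_obstacle_nonneg`). To pass from step functions to smooth functions, f is
sampled on a grid: the transform of a sample is a combination of translates of log|sin(u/2)|, and
summation by parts with L¹-continuity of translations gives convergence in L¹
(`tendsto_lintegral_gridHilbert_sub`). Fatou's lemma then finishes the passage.

If Ψ is convex, every disc mean is concave in y, hence so is the infimum once it is finite.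
Finiteness combines this concavity with potential theory on one complex line: a sub-mean function
that is -∞ on a vertical ray would be -∞ at a real point (`SubMean.ne_bot`). -/

instance fact_two_pi_pos : Fact (0 < 2 * Real.pi) := ⟨Real.two_pi_pos⟩

/-- The circle `ℝ / 2πℤ`. -/
abbrev Circ : Type := AddCircle (2 * Real.pi)

/-- Normalised Haar measure on the circle. -/
abbrev circMeasure : Measure Circ := AddCircle.haarAddCircle

/-! ### Analytic discs, the disc envelope and its sub-mean value property -/

section Envelope

variable {E : Type*} [AddCommGroup E] [Module ℂ E]

variable (E) in
/-- Boundary values of vector-valued analytic polynomials vanishing at the origin. -/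
def analyticPoly : Submodule ℂ (Circ → E) :=
  Submodule.span ℂ {F | ∃ k : ℕ, 0 < k ∧ ∃ v : E, F = fun θ => fourier (k : ℤ) θ • v}

theorem fourier_smul_mem_analyticPoly {k : ℤ} (hk : 0 < k) (v : E) :
    (fun θ : Circ => fourier k θ • v) ∈ analyticPoly E := by
  lift k to ℕ using hk.le
  exact Submodule.subset_span ⟨k, by exact_mod_cast hk, v, rfl⟩

/-- Multiplying a high power substitution of an analytic polynomial by a trigonometric polynomial
gives an analytic polynomial. -/
theorem exists_forall_trig_smul_mem_analyticPoly {T : C(Circ, ℂ)}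
    (hT : T ∈ Submodule.span ℂ (range (fourier (T := 2 * Real.pi)))) :
    ∃ d : ℕ, ∀ n : ℕ, d ≤ n → ∀ F ∈ analyticPoly E, ∀ α : Circ,
      (fun θ => T θ • F (n • θ + α)) ∈ analyticPoly E := by
  induction hT using Submodule.span_induction with
  | mem T h =>
    obtain ⟨l, rfl⟩ := h
    -- The product has frequency l + kn with k ≥ 1, which is positive as soon as n > |l|.
    refine ⟨l.natAbs + 1, fun n hn F hF α => ?_⟩
    induction hF using Submodule.span_induction with
    | mem F h =>
      obtain ⟨k, hk, v, rfl⟩ := h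
      have hpos : 0 < l + (k : ℤ) * n := by
        have h1 : (n : ℤ) ≤ k * n := by nlinarith
        omega
      convert fourier_smul_mem_analyticPoly hpos (fourier (k : ℤ) α • v) using 2 with θ
      rw [smul_smul, smul_smul]
      congr 1
      simp only [fourier_apply, smul_add, add_smul, AddCircle.toCircle_add, Circle.coe_mul, mul_smul,
        natCast_zsmul]
      ring
    | zero =>
      convert (analyticPoly E).zero_mem using 1
      ext θ
      simp
    | add F G _ _ hF hG =>
      convert (analyticPoly E).add_mem hF hG using 1
      ext θ
      simp
    | smul c F _ hF =>
      convert (analyticPoly E).smul_mem c hF using 1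
      ext θ
      simp [smul_comm c]
  | zero =>
    refine ⟨0, fun n _ F _ α => ?_⟩
    convert (analyticPoly E).zero_mem using 1
    ext θ
    simp
  | add S T _ _ hS hT =>
    obtain ⟨d, hd⟩ := hS
    obtain ⟨e, he⟩ := hT
    refine ⟨max d e, fun n hn F hF α => ?_⟩
    convert (analyticPoly E).add_mem (hd n (le_trans (le_max_left _ _) hn) F hF α)
      (he n (le_trans (le_max_right _ _) hn) F hF α) using 1
    ext θ
    simp [add_smul]
  | smul c T _ hT =>
    obtain ⟨d, hd⟩ := hT
    refine ⟨d, fun n hn F hF α => ?_⟩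
    convert (analyticPoly E).smul_mem c (hd n hn F hF α) using 1
    ext θ
    simp [mul_smul]

/-- The mean of `V` over the boundary of the analytic disc with centre `p` given by `F`. -/
def discMean (V : E → ℝ) (F : Circ → E) (p : E) : ℝ :=
  ∫ θ, V (p + F θ) ∂circMeasure

/-- The disc envelope of `V`: the infimum of the means of `V` over the boundaries of the
polynomial analytic discs with a given centre. -/
def discEnvelope (V : E → ℝ) (p : E) : EReal :=
  ⨅ F : analyticPoly E, (discMean V F p : EReal)

theorem discEnvelope_le_discMean (V : E → ℝ) {F : Circ → E} (hF : F ∈ analyticPoly E) (p : E) :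
    discEnvelope V p ≤ (discMean V F p : EReal) :=
  iInf_le (fun F : analyticPoly E => (discMean V F p : EReal)) ⟨F, hF⟩

theorem discEnvelope_le (V : E → ℝ) (p : E) : discEnvelope V p ≤ (V p : EReal) := by
  simpa [discMean] using discEnvelope_le_discMean V (analyticPoly E).zero_mem p

theorem discEnvelope_ne_top (V : E → ℝ) (p : E) : discEnvelope V p ≠ ⊤ :=
  ((discEnvelope_le V p).trans_lt (EReal.coe_lt_top _)).ne

variable [TopologicalSpace E] [IsTopologicalAddGroup E] [ContinuousSMul ℂ E]

theorem continuous_of_mem_analyticPoly {F : Circ → E} (hF : F ∈ analyticPoly E) :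
    Continuous F := by
  induction hF using Submodule.span_induction with
  | mem F h =>
    obtain ⟨k, -, v, rfl⟩ := h
    exact (fourier (k : ℤ)).continuous.smul continuous_const
  | zero => exact continuous_const
  | add F G _ _ hF hG => exact hF.add hG
  | smul c F _ hF => exact hF.const_smul c

/-- `E` need not be locally compact, but the circle is compact: currying makes p ↦ V(p + F ·)
continuous into the sup norm, and the mean is 1-Lipschitz for that norm. -/
theorem continuous_discMean {V : E → ℝ} (hV : Continuous V) {F : Circ → E}
    (hF : F ∈ analyticPoly E) : Continuous (discMean V F) := by
  have hF' := continuous_of_mem_analyticPoly hF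
  let G : C(E × Circ, ℝ) := ⟨fun q => V (q.1 + F q.2), by fun_prop⟩
  rw [continuous_iff_continuousAt]
  intro p
  have hG : Tendsto (fun q => G.curry q) (𝓝 p) (𝓝 (G.curry p)) := G.curry.continuous.tendsto p
  rw [tendsto_iff_norm_sub_tendsto_zero] at hG
  refine tendsto_iff_norm_sub_tendsto_zero.2
    (squeeze_zero (fun _ => norm_nonneg _) (fun q => ?_) hG)
  have hint : ∀ r, Integrable (fun θ => V (r + F θ)) circMeasure := fun r =>
    Continuous.integrable_of_hasCompactSupport (by fun_prop) (HasCompactSupport.of_compactSpace _)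
  rw [discMean, discMean, ← integral_sub (hint q) (hint p)]
  refine (norm_integral_le_of_norm_le_const (C := ‖G.curry q - G.curry p‖)
    (Eventually.of_forall fun θ => ?_)).trans (by simp)
  exact ContinuousMap.norm_coe_le_norm (G.curry q - G.curry p) θ

theorem upperSemicontinuous_discEnvelope {V : E → ℝ} (hV : Continuous V) :
    UpperSemicontinuous (discEnvelope V) := by
  refine upperSemicontinuous_iInf fun F => Continuous.upperSemicontinuous ?_
  exact continuous_coe_real_ereal.comp (continuous_discMean hV F.2)

/-- Trigonometric polynomial coefficients: the gluing inequality. -/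
theorem discEnvelope_le_integral_trig {V : E → ℝ} (hV : Continuous V) {ι : Type*} (s : Finset ι)
    (T : ι → C(Circ, ℂ)) (hT : ∀ i, T i ∈ Submodule.span ℂ (range (fourier (T := 2 * Real.pi))))
    (F : ι → Circ → E) (hF : ∀ i, F i ∈ analyticPoly E) (p v : E) :
    discEnvelope V p ≤ ((∫ θ, ∫ φ, V (p + (fourier 1 θ • v + ∑ i ∈ s, T i θ • F i φ))
      ∂circMeasure ∂circMeasure : ℝ) : EReal) := by
  choose d hd using fun i => exists_forall_trig_smul_mem_analyticPoly (E := E) (hT i)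
  have hF' := fun i => continuous_of_mem_analyticPoly (hF i)
  set n := s.sup d
  let W : Circ → Circ → ℝ := fun θ φ => V (p + (fourier 1 θ • v + ∑ i ∈ s, T i θ • F i φ))
  have hW : Continuous (Function.uncurry W) := by
    apply hV.comp
    fun_prop
  have hmem : ∀ α : Circ, (fun θ : Circ => fourier 1 θ • v + ∑ i ∈ s, T i θ • F i (n • θ + α)) ∈
      analyticPoly E := by
    intro α
    have h1 := (analyticPoly E).add_mem (fourier_smul_mem_analyticPoly one_pos v)
      ((analyticPoly E).sum_mem fun i (hi : i ∈ s) =>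
        hd i n (Finset.le_sup (f := d) hi) (F i) (hF i) α)
    convert h1 using 1
    ext θ
    simp
  have hle : ∀ α, discEnvelope V p ≤ ((∫ θ, W θ (n • θ + α) ∂circMeasure : ℝ) : EReal) :=
    fun α => discEnvelope_le_discMean V (hmem α) p
  have hcont : Continuous (Function.uncurry fun α θ : Circ => W θ (n • θ + α)) :=
    hW.comp (f := fun q : Circ × Circ => (q.2, n • q.2 + q.1)) (by fun_prop)
  have hint : Integrable (Function.uncurry fun α θ : Circ => W θ (n • θ + α))
      (circMeasure.prod circMeasure) :=
    hcont.integrable_of_hasCompactSupport (HasCompactSupport.of_compactSpace _)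
  -- Some rotation α does no worse than the average over all α. By Fubini and translation
  -- invariance, that average replaces nθ + α by an independent angle φ.
  obtain ⟨α, hα⟩ := exists_le_integral (μ := circMeasure) hint.integral_prod_left
  refine (hle α).trans (EReal.coe_le_coe_iff.2 (hα.trans_eq ?_))
  refine (integral_integral_swap (f := fun α θ : Circ => W θ (n • θ + α)) hint).trans ?_
  exact integral_congr_ae (Eventually.of_forall fun θ =>
    integral_add_left_eq_self (μ := circMeasure) (W θ) (n • θ))

/-- Indicator functions of measurable sets are almost everywhere limits of bounded sequences of
trigonometric polynomials. -/
theorem exists_trig_tendsto_indicator {B : Set Circ} (hB : MeasurableSet B) :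
    ∃ T : ℕ → C(Circ, ℂ),
      (∀ m, T m ∈ Submodule.span ℂ (range (fourier (T := 2 * Real.pi)))) ∧
      (∀ m θ, ‖T m θ‖ ≤ 2) ∧
      ∀ᵐ θ ∂circMeasure, Tendsto (fun m => T m θ) atTop (𝓝 (B.indicator 1 θ)) := by
  have hmem : MemLp (B.indicator (1 : Circ → ℝ)) 1 circMeasure :=
    (memLp_const (1 : ℝ)).indicator hB
  choose g hg hg' using fun m : ℕ => hmem.exists_boundedContinuous_eLpNorm_sub_le ENNReal.one_ne_top
    (ε := ((m : ℝ≥0∞) + 1)⁻¹) (by simp)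
  have hmeas : TendstoInMeasure circMeasure (fun m => (g m : Circ → ℝ)) atTop
      (B.indicator (1 : Circ → ℝ)) := by
    refine tendstoInMeasure_of_tendsto_eLpNorm one_ne_zero
      (fun m => (g m).continuous.aestronglyMeasurable) hmem.1 ?_
    refine tendsto_of_tendsto_of_tendsto_of_le_of_le tendsto_const_nhds
      (h := fun m : ℕ => ((m : ℝ≥0∞) + 1)⁻¹) ?_ (fun _ => zero_le) (fun m => ?_)
    · have := (ENNReal.tendsto_inv_nat_nhds_zero).comp (tendsto_add_atTop_nat 1)
      simpa [Function.comp_def] using this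
    · rw [eLpNorm_sub_comm]
      exact hg m
  obtain ⟨ns, -, hns⟩ := hmeas.exists_seq_tendsto_ae
  -- Clamping to [0, 1] keeps the limit, since an indicator takes values there, and supplies the
  -- uniform bound needed later for dominated convergence.
  let c : ℕ → C(Circ, ℂ) := fun m =>
    ⟨fun θ => ((max 0 (min 1 (g (ns m) θ)) : ℝ) : ℂ), by
      have := (g (ns m)).continuous
      fun_prop⟩
  have hc : ∀ m θ, ‖c m θ‖ ≤ 1 := fun m θ => by
    change ‖((max 0 (min 1 (g (ns m) θ)) : ℝ) : ℂ)‖ ≤ 1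
    rw [Complex.norm_real, Real.norm_of_nonneg (le_max_left _ _)]
    exact max_le zero_le_one (min_le_left _ _)
  have hdense : ∀ m : ℕ, ∃ S ∈ Submodule.span ℂ (range (fourier (T := 2 * Real.pi))),
      dist (c m) S < 1 / ((m : ℝ) + 1) := by
    intro m
    have : c m ∈ closure ((Submodule.span ℂ (range (fourier (T := 2 * Real.pi))) :
        Submodule ℂ C(Circ, ℂ)) : Set C(Circ, ℂ)) := by
      rw [← Submodule.topologicalClosure_coe, span_fourier_closure_eq_top]
      trivial
    exact Metric.mem_closure_iff.1 this _ Nat.one_div_pos_of_nat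
  choose T hT hTc using hdense
  have hdist : ∀ m θ, dist (c m θ) (T m θ) ≤ 1 / ((m : ℝ) + 1) := fun m θ =>
    (ContinuousMap.dist_apply_le_dist θ).trans (hTc m).le
  refine ⟨T, hT, fun m θ => ?_, ?_⟩
  · have h1 := hdist m θ
    have h2 : 1 / ((m : ℝ) + 1) ≤ 1 := by
      rw [div_le_one (by positivity)]
      linarith [(Nat.cast_nonneg m : (0 : ℝ) ≤ m)]
    rw [dist_eq_norm, norm_sub_rev] at h1
    have h3 : T m θ = c m θ + (T m θ - c m θ) := by ring
    rw [h3]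
    exact (norm_add_le _ _).trans (by linarith [hc m θ])
  · filter_upwards [hns] with θ hθ
    have hcl : Tendsto (fun m => c m θ) atTop (𝓝 (B.indicator 1 θ)) := by
      have h1 : Tendsto (fun m => ((max 0 (min 1 (g (ns m) θ)) : ℝ) : ℂ)) atTop
          (𝓝 ((max 0 (min 1 (B.indicator (1 : Circ → ℝ) θ)) : ℝ) : ℂ)) :=
        (Complex.continuous_ofReal.tendsto _).comp
          (tendsto_const_nhds.max (tendsto_const_nhds.min hθ))
      have hv : ((max 0 (min 1 (B.indicator (1 : Circ → ℝ) θ)) : ℝ) : ℂ) = B.indicator 1 θ := by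
        by_cases h : θ ∈ B <;> simp [h]
      rw [← hv]
      exact h1
    have hd0 : Tendsto (fun m => dist (T m θ) (c m θ)) atTop (𝓝 0) :=
      squeeze_zero (fun _ => dist_nonneg) (fun m => (dist_comm _ _).trans_le (hdist m θ))
        tendsto_one_div_add_atTop_nhds_zero_nat
    exact tendsto_of_tendsto_of_dist hcl (by simpa [dist_comm] using hd0)

/-- The gluing inequality for a measurable choice among finitely many discs. -/
theorem discEnvelope_le_integral_indicator {V : E → ℝ} (hV : Continuous V) {ι : Type*}
    (s : Finset ι) (B : ι → Set Circ) (hB : ∀ i, MeasurableSet (B i))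
    (F : ι → Circ → E) (hF : ∀ i, F i ∈ analyticPoly E) (p v : E) :
    Integrable (fun q : Circ × Circ => V (p + (fourier 1 q.1 • v +
      ∑ i ∈ s, ((B i).indicator 1 q.1 : ℂ) • F i q.2))) (circMeasure.prod circMeasure) ∧
    discEnvelope V p ≤ ((∫ q : Circ × Circ, V (p + (fourier 1 q.1 • v +
      ∑ i ∈ s, ((B i).indicator 1 q.1 : ℂ) • F i q.2)) ∂(circMeasure.prod circMeasure) : ℝ) :
        EReal) := by
  choose T hT hTb hTlim using fun i => exists_trig_tendsto_indicator (hB i)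
  have hF' := fun i => continuous_of_mem_analyticPoly (hF i)
  -- All coefficients lie in the disc of radius 2, so every integrand takes values in one compact
  -- set; this provides the dominating constant.
  have hcomp : IsCompact ((fun r : (Circ × Circ) × (s → ℂ) => V (p + (fourier 1 r.1.1 • v +
      ∑ i : s, r.2 i • F i r.1.2))) '' (univ ×ˢ (Set.univ.pi fun _ => Metric.closedBall 0 2))) := by
    refine (isCompact_univ.prod (isCompact_univ_pi fun _ => isCompact_closedBall _ _)).image
      (hV.comp ?_)
    fun_prop
  obtain ⟨M, hM⟩ := hcomp.isBounded.exists_norm_le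
  have hbound : ∀ m (q : Circ × Circ), ‖V (p + (fourier 1 q.1 • v + ∑ i ∈ s, T i m q.1 • F i q.2))‖
      ≤ M := by
    intro m q
    refine hM _ ⟨(q, fun i => T i m q.1), ⟨mem_univ _, fun i _ => ?_⟩, ?_⟩
    · simpa using hTb i m q.1
    · dsimp only
      rw [Finset.sum_coe_sort s (fun i => T i m q.1 • F i q.2)]
  have hmeas : ∀ m, AEStronglyMeasurable (fun q : Circ × Circ => V (p + (fourier 1 q.1 • v +
      ∑ i ∈ s, T i m q.1 • F i q.2))) (circMeasure.prod circMeasure) :=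
    fun m => Continuous.aestronglyMeasurable (hV.comp (by fun_prop))
  have hpt : ∀ᵐ q : Circ × Circ ∂(circMeasure.prod circMeasure),
      Tendsto (fun m => V (p + (fourier 1 q.1 • v + ∑ i ∈ s, T i m q.1 • F i q.2))) atTop
        (𝓝 (V (p + (fourier 1 q.1 • v +
          ∑ i ∈ s, ((B i).indicator 1 q.1 : ℂ) • F i q.2)))) := by
    have hall : ∀ᵐ θ ∂circMeasure, ∀ i ∈ s,
        Tendsto (fun m => T i m θ) atTop (𝓝 ((B i).indicator 1 θ)) :=
      (ae_ball_iff (Finset.countable_toSet s)).2 fun i _ => hTlim i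
    filter_upwards [Measure.quasiMeasurePreserving_fst.ae hall] with q hq
    refine (hV.tendsto _).comp (tendsto_const_nhds.add (tendsto_const_nhds.add ?_))
    exact tendsto_finsetSum _ fun i hi => (hq i hi).smul_const _
  refine ⟨Integrable.of_bound (aestronglyMeasurable_of_tendsto_ae _ hmeas hpt) M ?_, ?_⟩
  · filter_upwards [hpt] with q hq
    exact le_of_tendsto hq.norm (Eventually.of_forall fun m => hbound m q)
  have hlim := tendsto_integral_of_dominated_convergence (fun _ => M) hmeas
      (integrable_const M) (fun m => Eventually.of_forall (hbound m)) hpt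
  refine ge_of_tendsto ((continuous_coe_real_ereal.tendsto _).comp hlim)
    (Eventually.of_forall fun m => ?_)
  refine (discEnvelope_le_integral_trig hV s (fun i => T i m) (fun i => hT i m) F hF p v).trans_eq ?_
  simp only [Function.comp]
  rw [integral_prod]
  exact Continuous.integrable_of_hasCompactSupport (hV.comp (by fun_prop))
    (HasCompactSupport.of_compactSpace _)

/-- The sub-mean value property of the disc envelope. -/
theorem discEnvelope_le_integral {V : E → ℝ} (hV : Continuous V) (p v : E) {g : Circ → ℝ}
    (hg : Continuous g) (h : ∀ θ, discEnvelope V (p + fourier 1 θ • v) ≤ (g θ : EReal)) :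
    discEnvelope V p ≤ ((∫ θ, g θ ∂circMeasure : ℝ) : EReal) := by
  refine EReal.le_of_forall_lt_iff_le.1 fun c hc => ?_
  set ε : ℝ := c - ∫ θ, g θ ∂circMeasure with hε
  have hεpos : 0 < ε := sub_pos.2 (EReal.coe_lt_coe_iff.1 hc)
  have hex : ∀ θ, ∃ F ∈ analyticPoly E, discMean V F (p + fourier 1 θ • v) < g θ + ε := by
    intro θ
    have h1 : discEnvelope V (p + fourier 1 θ • v) < ((g θ + ε : ℝ) : EReal) :=
      (h θ).trans_lt (EReal.coe_lt_coe_iff.2 (by linarith))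
    obtain ⟨F, hF⟩ := iInf_lt_iff.1 h1
    exact ⟨F, F.2, EReal.coe_lt_coe_iff.1 hF⟩
  choose F hF hFlt using hex
  -- A disc that is near-optimal at θ remains so on an open set, so finitely many discs serve the
  -- whole circle.
  let O : Circ → Set Circ := fun θ => {τ | discMean V (F θ) (p + fourier 1 τ • v) < g τ + ε}
  have hO : ∀ θ, IsOpen (O θ) := fun θ =>
    isOpen_lt ((continuous_discMean hV (hF θ)).comp (by fun_prop)) (by fun_prop)
  obtain ⟨t, ht⟩ := isCompact_univ.elim_finite_subcover O hO
    fun θ _ => mem_iUnion.2 ⟨θ, hFlt θ⟩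
  let e := t.equivFin
  let O' : ℕ → Set Circ := fun i => if hi : i < t.card then O (e.symm ⟨i, hi⟩) else ∅
  have hO' : ∀ i, MeasurableSet (O' i) := fun i => by
    simp only [O']
    split_ifs
    · exact (hO _).measurableSet
    · exact MeasurableSet.empty
  let G : ℕ → Circ → E := fun i => if hi : i < t.card then F (e.symm ⟨i, hi⟩) else 0
  have hG : ∀ i, G i ∈ analyticPoly E := fun i => by
    simp only [G]
    split_ifs
    · exact hF _
    · exact (analyticPoly E).zero_mem
  have hlt : ∀ i τ, τ ∈ O' i → i < t.card ∧ discMean V (G i) (p + fourier 1 τ • v) < g τ + ε := by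
    intro i τ hτ
    by_cases hi : i < t.card
    · simp only [O', G, hi, dif_pos] at hτ ⊢
      exact ⟨trivial, hτ⟩
    · simp [O', hi] at hτ
  -- Making the cover disjoint selects exactly one disc for each angle.
  let B := disjointed O'
  have hBm : ∀ i, MeasurableSet (B i) := fun i => MeasurableSet.disjointed hO' i
  have hcover : ∀ τ, ∃ i, τ ∈ B i := by
    intro τ
    have h1 : τ ∈ ⋃ i, O' i := by
      obtain ⟨θ, hθt, hθ⟩ := mem_iUnion₂.1 (ht (mem_univ τ))
      refine mem_iUnion.2 ⟨e ⟨θ, hθt⟩, ?_⟩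
      simpa [O'] using hθ
    rw [← iUnion_disjointed] at h1
    exact mem_iUnion.1 h1
  have hsum : ∀ τ i, τ ∈ B i → ∀ φ, ∑ j ∈ Finset.range t.card,
      ((B j).indicator 1 τ : ℂ) • G j φ = G i φ := by
    intro τ i hi φ
    have hit := (hlt i τ (disjointed_subset O' i hi)).1
    rw [Finset.sum_eq_single_of_mem i (Finset.mem_range.2 hit)]
    · simp [hi]
    · intro j _ hji
      have : τ ∉ B j := fun hj => Set.disjoint_left.1 (disjoint_disjointed O' hji) hj hi
      simp [this]
  obtain ⟨hint, hle⟩ :=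
    discEnvelope_le_integral_indicator hV (Finset.range t.card) B hBm G hG p v
  refine hle.trans ?_
  rw [EReal.coe_le_coe_iff]
  rw [integral_prod _ hint]
  have hgi : Integrable g circMeasure :=
    hg.integrable_of_hasCompactSupport (HasCompactSupport.of_compactSpace _)
  calc _ ≤ ∫ θ, (g θ + ε) ∂circMeasure := by
        refine integral_mono hint.integral_prod_left (hgi.add (integrable_const _)) fun θ => ?_
        obtain ⟨i, hi⟩ := hcover θ
        simp only [hsum θ i hi, ← add_assoc]
        exact (hlt i θ (disjointed_subset O' i hi)).2.le
    _ = c := by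
        rw [integral_add hgi (integrable_const _)]
        simp [hε]

end Envelope

/-! ### From the sub-mean value property to subharmonicity, and propagation of the value -∞ -/

theorem circleAverage_eq_integral (f : ℂ → ℝ) (c : ℂ) (R : ℝ) :
    Real.circleAverage f c R = ∫ θ : Circ, f (c + R * fourier 1 θ) ∂circMeasure := by
  rw [Real.circleAverage, AddCircle.integral_haarAddCircle,
    ← AddCircle.intervalIntegral_preimage (2 * Real.pi) 0, zero_add]
  congr 1
  refine intervalIntegral.integral_congr fun θ _ => ?_
  simp only [circleMap, fourier_coe_apply]
  congr 3
  push_cast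
  field_simp

theorem integral_fourier_one : ∫ θ : Circ, (fourier 1 θ : ℂ) ∂circMeasure = 0 :=
  integral_eq_zero_of_add_right_eq_neg (μ := circMeasure)
    (g := ((2 * Real.pi / 2 / (1 : ℤ) : ℝ) : Circ))
    fun x => fourier_add_half_inv_index one_ne_zero Real.two_pi_pos x

theorem integral_norm_sq_circle (z : ℂ) (r : ℝ) :
    ∫ θ : Circ, ‖z + r * fourier 1 θ‖ ^ 2 ∂circMeasure = ‖z‖ ^ 2 + r ^ 2 := by
  have hexp : ∀ θ : Circ, ‖z + r * fourier 1 θ‖ ^ 2 =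
      ‖z‖ ^ 2 + r ^ 2 + Complex.reCLM (2 * r * (starRingEnd ℂ z) * fourier 1 θ) := by
    intro θ
    have h1 : ‖(fourier 1 θ : ℂ)‖ ^ 2 = 1 := by
      rw [fourier_apply, Circle.norm_coe, one_pow]
    rw [← Complex.normSq_eq_norm_sq] at h1 ⊢
    rw [← Complex.normSq_eq_norm_sq]
    simp only [Complex.normSq_apply, Complex.add_re, Complex.mul_re, Complex.add_im,
      Complex.mul_im, Complex.ofReal_re, Complex.ofReal_im, Complex.reCLM_apply, Complex.conj_re,
      Complex.conj_im, Complex.re_ofNat, Complex.im_ofNat] at h1 ⊢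
    linear_combination r ^ 2 * h1
  have hint : Integrable (fun θ : Circ => 2 * (r : ℂ) * (starRingEnd ℂ z) * fourier 1 θ)
      circMeasure :=
    Continuous.integrable_of_hasCompactSupport (by fun_prop) (HasCompactSupport.of_compactSpace _)
  simp only [hexp]
  rw [integral_add (integrable_const _) (Complex.reCLM.integrable_comp hint),
    Complex.reCLM.integral_comp_comm hint, integral_const_mul, integral_fourier_one]
  simp

/-- The sub-mean value property, tested against continuous majorants on circles. -/
def SubMean (u : ℂ → EReal) : Prop :=
  ∀ (z : ℂ) (r : ℝ) (g : Circ → ℝ), Continuous g →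
    (∀ θ, u (z + r * fourier 1 θ) ≤ (g θ : EReal)) →
      u z ≤ ((∫ θ, g θ ∂circMeasure : ℝ) : EReal)

theorem continuous_circle_comp {K : Set ℂ} {h : ℂ → ℝ} (hh : ContinuousOn h K) {z : ℂ} {r : ℝ}
    (hr : 0 ≤ r) (hK : Metric.closedBall z r ⊆ K) :
    Continuous fun θ : Circ => h (z + r * fourier 1 θ) := by
  refine hh.comp_continuous (by fun_prop) fun θ => hK ?_
  rw [mem_closedBall_iff_norm, add_sub_cancel_left, norm_mul, fourier_apply, Circle.norm_coe,
    mul_one, Complex.norm_real, Real.norm_of_nonneg hr]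

theorem circle_mem_closedBall (z : ℂ) {r : ℝ} (hr : 0 ≤ r) (θ : Circ) :
    z + r * fourier 1 θ ∈ Metric.closedBall z r := by
  rw [mem_closedBall_iff_norm, add_sub_cancel_left, norm_mul, fourier_apply, Circle.norm_coe,
    mul_one, Complex.norm_real, Real.norm_of_nonneg hr]

/-- Maximum principle: u - h + η|z|² has a strict sub-mean inequality, with gain η r² on a circle of
radius r, so it cannot attain a finite maximum over `K` at an interior point. Then η → 0. It is
applied to discs and to a rectangle. -/
theorem SubMean.le_of_le_frontier {u : ℂ → EReal} (hu : SubMean u) (husc : UpperSemicontinuous u)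
    (htop : ∀ z, u z ≠ ⊤) {K : Set ℂ} (hK : IsCompact K) {h : ℂ → ℝ} (hh : ContinuousOn h K)
    (hmean : ∀ z r, 0 < r → Metric.closedBall z r ⊆ interior K →
      ∫ θ : Circ, h (z + r * fourier 1 θ) ∂circMeasure = h z)
    (hle : ∀ z ∈ K, z ∉ interior K → u z ≤ (h z : EReal)) :
    ∀ z ∈ K, u z ≤ (h z : EReal) := by
  intro z hz
  obtain ⟨R, hR⟩ := hK.isBounded.exists_norm_le
  have key : ∀ η : ℝ, 0 < η → u z ≤ ((h z + η * R ^ 2 : ℝ) : EReal) := by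
    intro η hη
    let w : ℂ → EReal := fun z => u z + ((η * ‖z‖ ^ 2 - h z : ℝ) : EReal)
    have hw : UpperSemicontinuousOn w K := by
      refine (husc.upperSemicontinuousOn K).add' ?_ fun z _ => ?_
      · refine ContinuousOn.upperSemicontinuousOn ?_
        exact continuous_coe_real_ereal.comp_continuousOn (by fun_prop)
      · exact EReal.continuousAt_add (.inl (htop z)) (.inr (EReal.coe_ne_top _))
    -- Solving for `u` needs a case split, as `u` may be -∞.
    have hback : ∀ (x : ℂ) (m : ℝ), w x ≤ m → u x ≤ ((m + h x - η * ‖x‖ ^ 2 : ℝ) : EReal) := by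
      intro x m hx
      simp only [w] at hx
      induction hux : u x with
      | bot => exact bot_le
      | top => exact absurd hux (htop x)
      | coe a =>
        rw [hux, ← EReal.coe_add, EReal.coe_le_coe_iff] at hx
        rw [EReal.coe_le_coe_iff]
        linarith
    obtain ⟨x, hxK, hx⟩ := hw.exists_isMaxOn ⟨z, hz⟩ hK
    have hfin : w x ≤ ((η * R ^ 2 : ℝ) : EReal) := by
      by_cases hxi : x ∈ interior K
      · obtain ⟨r, hr, hrK⟩ := Metric.nhds_basis_closedBall.mem_iff.1
          (isOpen_interior.mem_nhds hxi)
        by_contra! hcon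
        obtain ⟨a, ha⟩ : ∃ a : ℝ, w x = a := by
          have h1 : w x ≠ ⊥ := (bot_le.trans_lt hcon).ne'
          have h2 : w x ≠ ⊤ := by
            simp only [w]
            exact EReal.add_ne_top (htop x) (EReal.coe_ne_top _)
          exact ⟨(w x).toReal, (EReal.coe_toReal h2 h1).symm⟩
        have hrK' := hrK.trans interior_subset
        have hcont := continuous_circle_comp hh hr.le hrK'
        have hcont2 : Continuous fun θ : Circ => η * ‖x + r * fourier 1 θ‖ ^ 2 := by fun_prop
        have h1 := hu x r (fun θ => a + h (x + r * fourier 1 θ) - η * ‖x + r * fourier 1 θ‖ ^ 2)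
          ((continuous_const.add hcont).sub hcont2) fun θ =>
            hback _ a ((hx (hrK' (circle_mem_closedBall x hr.le θ))).trans_eq ha)
        have hi : ∀ f : Circ → ℝ, Continuous f → Integrable f circMeasure := fun f hf =>
          hf.integrable_of_hasCompactSupport (HasCompactSupport.of_compactSpace _)
        have hcont1 : Continuous fun θ : Circ => a + h (x + r * fourier 1 θ) :=
          continuous_const.add hcont
        rw [integral_sub (hi _ hcont1) (hi _ hcont2),
          integral_add (integrable_const _) (hi _ hcont), hmean x r hr hrK, integral_const_mul,
          integral_norm_sq_circle] at h1
        simp only [integral_const, probReal_univ, one_smul] at h1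
        simp only [w] at ha
        induction hux : u x with
        | bot => simp [hux] at ha
        | top => exact htop x hux
        | coe b =>
          rw [hux, EReal.coe_le_coe_iff] at h1
          rw [hux, ← EReal.coe_add, EReal.coe_eq_coe_iff] at ha
          -- The sub-mean inequality reads b ≤ b - η r², which is absurd.
          nlinarith [mul_pos hη (pow_pos hr 2)]
      · have h1 := hle x hxK hxi
        have h2 : ‖x‖ ^ 2 ≤ R ^ 2 := pow_le_pow_left₀ (norm_nonneg _) (hR x hxK) 2
        calc w x ≤ (h x : EReal) + ((η * ‖x‖ ^ 2 - h x : ℝ) : EReal) := by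
              simp only [w]; gcongr
          _ ≤ _ := by
              rw [← EReal.coe_add, EReal.coe_le_coe_iff]
              nlinarith
    refine (hback z (η * R ^ 2) ((hx hz).trans hfin)).trans (EReal.coe_le_coe_iff.2 ?_)
    nlinarith [mul_nonneg hη.le (sq_nonneg ‖z‖)]
  have hlim : Tendsto (fun η : ℝ => ((h z + η * R ^ 2 : ℝ) : EReal)) (𝓝[>] 0) (𝓝 (h z : EReal)) := by
    refine (continuous_coe_real_ereal.tendsto _).comp ?_
    have : Continuous fun η : ℝ => h z + η * R ^ 2 := by fun_prop
    exact tendsto_nhdsWithin_of_tendsto_nhds (by simpa using this.tendsto 0)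
  exact ge_of_tendsto hlim (eventually_nhdsWithin_of_forall key)

theorem SubMean.subharmonic {u : ℂ → EReal} (hu : SubMean u) (husc : UpperSemicontinuous u)
    (htop : ∀ z, u z ≠ ⊤) : Subharmonic u := by
  refine ⟨htop, husc, fun c r hr g hg hharm hle z hz => ?_⟩
  refine hu.le_of_le_frontier husc htop (isCompact_closedBall c r) hg ?_ ?_ z
    (Metric.ball_subset_closedBall hz)
  · intro x s hs hsub
    rw [interior_closedBall c hr.ne'] at hsub
    rw [← circleAverage_eq_integral]
    exact InnerProductSpace.HarmonicOnNhd.circleAverage_eq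
      (hharm.mono (by rwa [abs_of_pos hs]))
  · intro x hx hxi
    rw [interior_closedBall c hr.ne', Metric.mem_ball, not_lt] at hxi
    exact hle x (le_antisymm hx hxi)

/-- A function with the sub-mean value property that is `-∞` on the half-line `{it : t ≥ 1}` and
bounded above by a continuous function is `-∞` near `1/4 + 3i/2`. -/
theorem SubMean.eq_bot_near {u : ℂ → EReal} (hu : SubMean u) (husc : UpperSemicontinuous u)
    {V : ℂ → ℝ} (hV : Continuous V) (hle : ∀ z, u z ≤ (V z : EReal))
    (hbot : ∀ z : ℂ, z.re = 0 → 1 ≤ z.im → u z = ⊥) {z : ℂ}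
    (hz : ‖z - (1 / 4 + 3 / 2 * Complex.I)‖ < 1 / 16) : u z = ⊥ := by
  have htop : ∀ z, u z ≠ ⊤ := fun z => ((hle z).trans_lt (EReal.coe_lt_top _)).ne
  set K : Set ℂ := Icc (0 : ℝ) (1 / 2) ×ℂ Icc (1 : ℝ) 2 with hKdef
  have hK : IsCompact K := isCompact_Icc.reProdIm isCompact_Icc
  obtain ⟨A, hA⟩ := hK.exists_bound_of_continuousOn hV.continuousOn
  have hint : interior K = Ioo (0 : ℝ) (1 / 2) ×ℂ Ioo (1 : ℝ) 2 := by
    rw [hKdef, Complex.interior_reProdIm, interior_Icc, interior_Icc]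
  -- A harmonic function centred at the midpoint of the right side of the rectangle: it is ≤ 0 on
  -- the other three sides, apart from the left one where u = -∞, and positive near 1/4 + 3i/2.
  -- Wherever it is positive on the boundary, u is -∞, so A - Mω dominates u there for every M ≥ 0,
  -- and M → ∞ gives the claim.
  let ω : ℂ → ℝ := fun z => ((z - (1 / 2 + 3 / 2 * Complex.I)) ^ 2).re
  have hω : ∀ z, ω z = (z.re - 1 / 2) ^ 2 - (z.im - 3 / 2) ^ 2 := by
    intro z
    simp only [ω, pow_two, Complex.mul_re, Complex.sub_re, Complex.sub_im, Complex.add_re,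
      Complex.add_im]
    norm_num
  have hre := (Complex.abs_re_le_norm _).trans_lt hz
  have him := (Complex.abs_im_le_norm _).trans_lt hz
  norm_num at hre him
  rw [abs_lt] at hre him
  have hzK : z ∈ K := by
    rw [hKdef, Complex.mem_reProdIm]
    exact ⟨⟨by linarith, by linarith⟩, ⟨by linarith, by linarith⟩⟩
  have hpos : 0 < ω z := by
    rw [hω]
    nlinarith
  have key : ∀ M : ℝ, 0 ≤ M → u z ≤ ((A - M * ω z : ℝ) : EReal) := by
    intro M hM
    refine hu.le_of_le_frontier husc htop hK (h := fun z => A - M * ω z) ?_ ?_ ?_ z hzK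
    · have : Continuous ω := by fun_prop
      fun_prop
    · intro x r hr _
      rw [← circleAverage_eq_integral (fun z => A - M * ω z)]
      have : (fun z => A - M * ω z) =
          fun z => ((A - M * (z - (1 / 2 + 3 / 2 * Complex.I)) ^ 2 : ℂ)).re := by
        ext z
        simp [ω]
      rw [this]
      refine Eq.trans (InnerProductSpace.HarmonicOnNhd.circleAverage_eq (F := ℝ) fun y _ => ?_)
        (congrFun this x).symm
      exact AnalyticAt.harmonicAt_re (by fun_prop)
    · intro x hx hxi
      have hxA : u x ≤ (A : EReal) :=
        (hle x).trans (EReal.coe_le_coe_iff.2 ((le_abs_self _).trans (hA x hx)))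
      by_cases hx0 : x.re = 0
      · rw [hbot x hx0 hx.2.1]
        exact bot_le
      · refine hxA.trans (EReal.coe_le_coe_iff.2 ?_)
        have hωx : ω x ≤ 0 := by
          rw [hint, Complex.mem_reProdIm] at hxi
          rw [hKdef, Complex.mem_reProdIm] at hx
          obtain ⟨⟨h1, h2⟩, h3, h4⟩ := hx
          have h1' : 0 < x.re := lt_of_le_of_ne h1 (Ne.symm hx0)
          rw [hω]
          rcases h2.eq_or_lt with h2 | h2
          · rw [h2]
            nlinarith [sq_nonneg (x.im - 3 / 2)]
          rcases h3.eq_or_lt with h3 | h3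
          · rw [← h3]
            nlinarith
          rcases h4.eq_or_lt with h4 | h4
          · rw [h4]
            nlinarith
          exact absurd ⟨⟨h1', h2⟩, h3, h4⟩ hxi
        nlinarith
  rw [EReal.eq_bot_iff_forall_lt]
  intro y
  refine (key ((|A - y| + 1) / ω z) (by positivity)).trans_lt (EReal.coe_lt_coe_iff.2 ?_)
  rw [div_mul_cancel₀ _ hpos.ne']
  linarith [le_abs_self (A - y)]

/-- Otherwise u = -∞ near 1/4 + 3i/2, the top point of the circle about 1/4 of radius 3/2. That is
an arc of positive measure, so the sub-mean inequality forces u(1/4) = -∞ at a real point. -/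
theorem SubMean.ne_bot {u : ℂ → EReal} (hu : SubMean u) (husc : UpperSemicontinuous u)
    {V : ℂ → ℝ} (hV : Continuous V) (hle : ∀ z, u z ≤ (V z : EReal))
    (hreal : ∀ s : ℝ, u s ≠ ⊥) : ∃ z : ℂ, z.re = 0 ∧ 1 ≤ z.im ∧ u z ≠ ⊥ := by
  by_contra! hcon
  obtain ⟨A, hA⟩ := (isCompact_closedBall (1 / 4 : ℂ) (3 / 2)).exists_bound_of_continuousOn
    hV.continuousOn
  -- A continuous bump supported where u = -∞; hence A - n b is an admissible majorant for every n ≥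
  -- 0.
  let b : Circ → ℝ := fun θ =>
    max 0 (1 / 16 - ‖((1 / 4 : ℝ) : ℂ) + (3 / 2 : ℝ) * fourier 1 θ - (1 / 4 + 3 / 2 * Complex.I)‖)
  have hb : Continuous b := by fun_prop
  have hint : Integrable b circMeasure :=
    hb.integrable_of_hasCompactSupport (HasCompactSupport.of_compactSpace _)
  have hpos : 0 < ∫ θ, b θ ∂circMeasure := by
    refine hb.integral_pos_of_hasCompactSupport_nonneg_nonzero
      (HasCompactSupport.of_compactSpace _) (fun θ => le_max_left _ _)
      (x := ((Real.pi / 2 : ℝ) : Circ)) ?_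
    have : (fourier 1 ((Real.pi / 2 : ℝ) : Circ) : ℂ) = Complex.I := by
      rw [fourier_coe_apply]
      convert Complex.exp_pi_div_two_mul_I using 2
      push_cast
      field_simp
    simp only [b, this]
    norm_num
  have key : ∀ n : ℝ, 0 ≤ n → u (1 / 4 : ℝ) ≤ ((A - n * ∫ θ, b θ ∂circMeasure : ℝ) : EReal) := by
    intro n hn
    have h1 := hu (1 / 4 : ℝ) (3 / 2) (fun θ => A - n * b θ) (by fun_prop) ?_
    · rw [integral_sub (integrable_const _) (hint.const_mul _), integral_const_mul] at h1
      simpa using h1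
    · intro θ
      by_cases hθ : ‖((1 / 4 : ℝ) : ℂ) + (3 / 2 : ℝ) * fourier 1 θ -
          (1 / 4 + 3 / 2 * Complex.I)‖ < 1 / 16
      · rw [hu.eq_bot_near husc hV hle hcon hθ]
        exact bot_le
      · have : b θ = 0 := max_eq_left (by linarith)
        rw [this, mul_zero, sub_zero]
        refine (hle _).trans (EReal.coe_le_coe_iff.2 ((le_abs_self _).trans (hA _ ?_)))
        have := circle_mem_closedBall ((1 / 4 : ℝ) : ℂ) (r := 3 / 2) (by norm_num) θ
        convert this using 2
        norm_num
  refine hreal (1 / 4) (EReal.eq_bot_iff_forall_lt _ |>.2 fun y => ?_)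
  refine (key ((|A - y| + 1) / ∫ θ, b θ ∂circMeasure) (by positivity)).trans_lt
    (EReal.coe_lt_coe_iff.2 ?_)
  rw [div_mul_cancel₀ _ hpos.ne']
  linarith [le_abs_self (A - y)]

/-! ### The logarithmic kernel and L¹-continuity of its translates -/

/-- The logarithmic kernel `log |sin (u / 2)|`, a primitive of `cot (u / 2) / 2`. -/
def logKernel (u : ℝ) : ℝ := Real.log (Real.sin (u / 2))

theorem logKernel_periodic : Function.Periodic logKernel (2 * Real.pi) := by
  intro u
  rw [logKernel, logKernel, show (u + 2 * Real.pi) / 2 = u / 2 + Real.pi by ring, Real.sin_add_pi,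
    Real.log_neg_eq_log]

theorem measurable_logKernel : Measurable logKernel :=
  Real.measurable_log.comp (by fun_prop)

theorem intervalIntegrable_logKernel (a b : ℝ) : IntervalIntegrable logKernel volume a b := by
  have h := (intervalIntegrable_log_sin (a := a / 2) (b := b / 2)).comp_mul_left (c := 1 / 2)
  have h2 : (fun x : ℝ => (Real.log ∘ Real.sin) (1 / 2 * x)) = logKernel := by
    ext x
    simp [logKernel, div_eq_inv_mul]
  rw [h2] at h
  convert h using 1 <;> ring

/-- The logarithmic kernel on the circle. -/
def circLogKernel (θ : Circ) : ℝ := Real.log (‖(fourier 1 θ : ℂ) - 1‖ / 2)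

theorem circLogKernel_coe (u : ℝ) : circLogKernel u = logKernel u := by
  have h : (fourier 1 (u : Circ) : ℂ) = Complex.exp (Complex.I * u) := by
    rw [fourier_coe_apply]
    congr 1
    push_cast
    field_simp
  rw [circLogKernel, logKernel, h, Complex.norm_exp_I_mul_ofReal_sub_one, Real.norm_eq_abs, abs_mul,
    abs_two, mul_div_cancel_left₀ _ two_ne_zero, Real.log_abs]

theorem measurable_circLogKernel : Measurable circLogKernel :=
  Real.measurable_log.comp (by fun_prop)

theorem memLp_circLogKernel : MemLp circLogKernel 1 (volume : Measure Circ) := by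
  refine ⟨measurable_circLogKernel.aestronglyMeasurable, ?_⟩
  rw [eLpNorm_one_eq_lintegral_enorm, ← AddCircle.lintegral_preimage (2 * Real.pi) 0]
  simp only [circLogKernel_coe]
  have h := intervalIntegrable_logKernel 0 (0 + 2 * Real.pi)
  rw [intervalIntegrable_iff_integrableOn_Ioc_of_le (by linarith [Real.pi_pos])] at h
  exact h.2

/-- Continuity of translations in `L¹` of the circle. -/
theorem tendsto_lintegral_translation_sub {f : Circ → ℝ} (hf : MemLp f 1 volume) :
    Tendsto (fun r : Circ => ∫⁻ t, ‖f (t - r) - f t‖ₑ) (𝓝 0) (𝓝 0) := by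
  rw [ENNReal.tendsto_nhds_zero]
  intro ε hε
  obtain ⟨δ, hδ, hδε⟩ : ∃ δ : ℝ≥0∞, 0 < δ ∧ δ + (δ + δ) ≤ ε := by
    refine ⟨ε / 3, ENNReal.div_pos hε.ne' (by simp), le_of_eq ?_⟩
    rw [← add_assoc, ENNReal.add_thirds]
  obtain ⟨g, hg, -⟩ := hf.exists_boundedContinuous_eLpNorm_sub_le ENNReal.one_ne_top hδ.ne'
  rw [eLpNorm_one_eq_lintegral_enorm] at hg
  simp only [Pi.sub_apply] at hg
  have hgu : UniformContinuous g := CompactSpace.uniformContinuous_of_continuous g.continuous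
  obtain ⟨η, hη, hηδ⟩ : ∃ η : ℝ, 0 < η ∧ ENNReal.ofReal η * ENNReal.ofReal (2 * Real.pi) ≤ δ := by
    rcases eq_or_ne δ ⊤ with rfl | hδt
    · exact ⟨1, one_pos, le_top⟩
    · refine ⟨δ.toReal / (2 * Real.pi), div_pos (ENNReal.toReal_pos hδ.ne' hδt) Real.two_pi_pos, ?_⟩
      rw [← ENNReal.ofReal_mul (by positivity), div_mul_cancel₀ _ Real.two_pi_pos.ne',
        ENNReal.ofReal_toReal hδt]
  obtain ⟨κ, hκ, hgκ⟩ := Metric.uniformContinuous_iff.1 hgu η hη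
  filter_upwards [Metric.ball_mem_nhds (0 : Circ) hκ] with r hr
  have hfm := hf.1
  have htr : ∫⁻ t, ‖f (t - r) - g (t - r)‖ₑ = ∫⁻ t : Circ, ‖f t - g t‖ₑ :=
    lintegral_sub_right_eq_self (fun t => ‖f t - g t‖ₑ) r
  have hgr : ∫⁻ t : Circ, ‖g (t - r) - g t‖ₑ ≤ δ := by
    calc ∫⁻ t : Circ, ‖g (t - r) - g t‖ₑ ≤ ∫⁻ _ : Circ, ENNReal.ofReal η := by
          refine lintegral_mono fun t => ?_
          rw [← ofReal_norm]
          refine ENNReal.ofReal_le_ofReal ?_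
          rw [← dist_eq_norm]
          refine (hgκ ?_).le
          rw [dist_eq_norm, sub_sub_cancel_left, norm_neg, ← dist_zero_right]
          exact hr
      _ ≤ δ := by
          rw [lintegral_const, AddCircle.measure_univ]
          exact hηδ
  calc ∫⁻ t, ‖f (t - r) - f t‖ₑ
      ≤ ∫⁻ t, (‖f t - g t‖ₑ + (‖f (t - r) - g (t - r)‖ₑ + ‖g (t - r) - g t‖ₑ)) := by
        refine lintegral_mono fun t => ?_
        have : f (t - r) - f t = -(f t - g t) + ((f (t - r) - g (t - r)) + (g (t - r) - g t)) := by
          ring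
        rw [this]
        refine (enorm_add_le _ _).trans ?_
        rw [enorm_neg]
        gcongr
        exact enorm_add_le _ _
    _ = (∫⁻ t, ‖f t - g t‖ₑ) + ((∫⁻ t, ‖f (t - r) - g (t - r)‖ₑ) +
          ∫⁻ t, ‖g (t - r) - g t‖ₑ) := by
        have hgc := g.continuous
        have hm1 : AEMeasurable (fun t => ‖f t - g t‖ₑ) volume :=
          (hfm.sub hgc.aestronglyMeasurable).enorm
        have hm2 : Measurable fun t => ‖g (t - r) - g t‖ₑ :=
          Continuous.measurable (by fun_prop)
        rw [lintegral_add_left' hm1, lintegral_add_right _ hm2]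
    _ ≤ ε := by
        rw [htr]
        exact (add_le_add hg (add_le_add hg hgr)).trans hδε

theorem lintegral_logKernel_sub (x y : ℝ) :
    ∫⁻ t in Ioc (-Real.pi) Real.pi, ‖logKernel (t - x) - logKernel (t - y)‖ₑ =
      ∫⁻ t : Circ, ‖circLogKernel (t - ((x - y : ℝ) : Circ)) - circLogKernel t‖ₑ := by
  have h := AddCircle.lintegral_preimage (2 * Real.pi) (-Real.pi)
    (fun t => ‖circLogKernel (t - x) - circLogKernel (t - y)‖ₑ)
  rw [show -Real.pi + 2 * Real.pi = Real.pi by ring] at h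
  have h2 := lintegral_sub_right_eq_self (μ := (volume : Measure Circ))
    (fun t => ‖circLogKernel (t - ((x - y : ℝ) : Circ)) - circLogKernel t‖ₑ) (y : Circ)
  rw [← h2]
  refine Eq.trans ?_ (h.trans (lintegral_congr fun t => ?_))
  · refine lintegral_congr fun t => ?_
    rw [← circLogKernel_coe, ← circLogKernel_coe]
    rfl
  · rw [AddCircle.coe_sub, sub_sub, add_sub_cancel]

/-- By translation invariance the integral depends only on x - y, so δ is uniform; this is what
bounds the sampling error on all grid cells at once. -/
theorem exists_delta_lintegral_logKernel_sub_le {ε : ℝ≥0∞} (hε : 0 < ε) :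
    ∃ δ > 0, ∀ x y : ℝ, |x - y| < δ →
      ∫⁻ t in Ioc (-Real.pi) Real.pi, ‖logKernel (t - x) - logKernel (t - y)‖ₑ ≤ ε := by
  have h := (ENNReal.tendsto_nhds_zero.1 (tendsto_lintegral_translation_sub memLp_circLogKernel)) ε hε
  have hc : Tendsto (fun r : ℝ => (r : Circ)) (𝓝 0) (𝓝 0) :=
    (AddCircle.continuous_mk' _).tendsto' 0 0 rfl
  obtain ⟨δ, hδ, hb⟩ := Metric.eventually_nhds_iff.1 (hc.eventually h)
  refine ⟨δ, hδ, fun x y hxy => ?_⟩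
  rw [lintegral_logKernel_sub]
  exact hb (by simpa [Real.dist_eq] using hxy)

/-! ### Fourier coefficients of the logarithmic kernel -/

theorem abs_sin_nat_mul_le (n : ℕ) (x : ℝ) : |Real.sin (n * x)| ≤ n * |Real.sin x| := by
  induction n with
  | zero => simp
  | succ n ih =>
    rw [Nat.cast_succ, add_mul, one_mul, Real.sin_add]
    calc _ ≤ |Real.sin (n * x)| * |Real.cos x| + |Real.cos (n * x)| * |Real.sin x| := by
          rw [← abs_mul, ← abs_mul]; exact abs_add_le _ _
      _ ≤ |Real.sin (n * x)| * 1 + 1 * |Real.sin x| := by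
          gcongr
          · exact Real.abs_cos_le_one x
          · exact Real.abs_cos_le_one _
      _ ≤ _ := by linarith

/-- It shows that sin((m+1)u) cot(u/2), the term produced by integrating the kernel by parts, is a
trigonometric polynomial. -/
theorem sin_nat_mul_cos_half (m : ℕ) (u : ℝ) :
    Real.sin ((m + 1) * u) * Real.cos (u / 2) = Real.sin (u / 2) *
      (1 + 2 * ∑ j ∈ Finset.range m, Real.cos ((j + 1) * u) + Real.cos ((m + 1) * u)) := by
  induction m with
  | zero =>
    have h1 : Real.sin u = 2 * Real.sin (u / 2) * Real.cos (u / 2) := by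
      rw [← Real.sin_two_mul]; ring_nf
    have h2 : Real.cos u = 2 * Real.cos (u / 2) ^ 2 - 1 := by
      rw [← Real.cos_two_mul]; ring_nf
    simp [h1, h2]
    ring
  | succ m ih =>
    have h3 : Real.sin ((m + 1 + 1) * u) * Real.cos (u / 2) - Real.sin ((m + 1) * u) *
        Real.cos (u / 2) = Real.sin (u / 2) * (Real.cos ((m + 1) * u) +
          Real.cos ((m + 1 + 1) * u)) := by
      have e1 : (m + 1) * u = (m + 3 / 2) * u - u / 2 := by ring
      have e2 : (m + 1 + 1) * u = (m + 3 / 2) * u + u / 2 := by ring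
      rw [e1, e2, Real.sin_add, Real.sin_sub, Real.cos_add, Real.cos_sub]
      ring
    rw [Finset.sum_range_succ]
    push_cast
    linear_combination ih + h3

theorem intervalIntegrable_cos_mul_logKernel (m : ℕ) (a b : ℝ) :
    IntervalIntegrable (fun u => Real.cos ((m + 1) * u) * logKernel u) volume a b :=
  (intervalIntegrable_logKernel _ _).continuousOn_mul (Continuous.continuousOn (by fun_prop))

theorem intervalIntegrable_sin_mul_logKernel (m : ℕ) (a b : ℝ) :
    IntervalIntegrable (fun u => Real.sin ((m + 1) * u) * logKernel u) volume a b :=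
  (intervalIntegrable_logKernel _ _).continuousOn_mul (Continuous.continuousOn (by fun_prop))

/-- Integration by parts gives the explicit primitive `G`. All sines vanish at 0 and 2π, so only the
linear term of `S` contributes, namely -2π / (2(m+1)). -/
theorem integral_cos_mul_logKernel (m : ℕ) :
    ∫ u in (0 : ℝ)..2 * Real.pi, Real.cos ((m + 1) * u) * logKernel u = -(Real.pi / (m + 1)) := by
  have hm : ((m : ℝ) + 1) ≠ 0 := by positivity
  let S : ℝ → ℝ := fun u => u + 2 * ∑ j ∈ Finset.range m, Real.sin ((j + 1) * u) / (j + 1) +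
    Real.sin ((m + 1) * u) / (m + 1)
  let G : ℝ → ℝ := fun u => Real.sin ((m + 1) * u) * logKernel u / (m + 1) -
    S u / (2 * (m + 1))
  have hsin : ∀ (j : ℕ) (u : ℝ), HasDerivAt (fun u => Real.sin ((j + 1) * u) / ((j : ℝ) + 1))
      (Real.cos ((j + 1) * u)) u := by
    intro j u
    have hj : ((j : ℝ) + 1) ≠ 0 := by positivity
    simpa [hj] using (((hasDerivAt_id u).const_mul ((j : ℝ) + 1)).sin).div_const ((j : ℝ) + 1)
  have hS : ∀ u, HasDerivAt S (1 + 2 * ∑ j ∈ Finset.range m, Real.cos ((j + 1) * u) +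
      Real.cos ((m + 1) * u)) u := fun u =>
    ((hasDerivAt_id u).add ((HasDerivAt.fun_sum fun j _ => hsin j u).const_mul 2)).add (hsin m u)
  -- At the singularities the product is bounded by a multiple of |x log x| with x = sin(u/2), so
  -- the primitive is continuous up to both endpoints.
  have hcont : Continuous fun u => Real.sin ((m + 1) * u) * logKernel u := by
    rw [continuous_iff_continuousAt]
    intro u
    by_cases hu : Real.sin (u / 2) = 0
    · have h0 : Tendsto (fun u : ℝ => Real.sin (u / 2) * Real.log (Real.sin (u / 2))) (𝓝 u) (𝓝 0) := by
        have hc : Continuous fun u : ℝ => Real.sin (u / 2) * Real.log (Real.sin (u / 2)) :=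
          Real.continuous_mul_log.comp (g := fun x => x * Real.log x)
            (f := fun u : ℝ => Real.sin (u / 2)) (by fun_prop)
        simpa [hu] using hc.tendsto u
      have hval : Real.sin ((m + 1) * u) * logKernel u = 0 := by simp [logKernel, hu]
      rw [ContinuousAt, hval]
      refine squeeze_zero_norm (a := fun u => (2 * (m + 1) : ℝ) *
        |Real.sin (u / 2) * Real.log (Real.sin (u / 2))|) (fun w => ?_) ?_
      · have := abs_sin_nat_mul_le (2 * (m + 1)) (w / 2)
        rw [Real.norm_eq_abs, abs_mul, abs_mul, ← mul_assoc, logKernel]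
        push_cast at this
        rw [show 2 * ((m : ℝ) + 1) * (w / 2) = (m + 1) * w by ring] at this
        gcongr
      · simpa using h0.abs.const_mul (2 * (m + 1) : ℝ)
    · unfold logKernel
      exact ContinuousAt.mul (by fun_prop) (ContinuousAt.log (by fun_prop) hu)
  have hG : ContinuousOn G (Icc 0 (2 * Real.pi)) := by
    have : Continuous S := continuous_iff_continuousAt.2 fun u => (hS u).continuousAt
    exact Continuous.continuousOn (by fun_prop)
  have hder : ∀ u ∈ Ioo 0 (2 * Real.pi), HasDerivAt G (Real.cos ((m + 1) * u) * logKernel u) u := by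
    intro u hu
    have hpos : 0 < Real.sin (u / 2) :=
      Real.sin_pos_of_pos_of_lt_pi (by linarith [hu.1]) (by linarith [hu.2])
    have hL : HasDerivAt logKernel (Real.cos (u / 2) * (1 / 2) / Real.sin (u / 2)) u :=
      (((hasDerivAt_id u).div_const 2).sin).log hpos.ne'
    have hs : HasDerivAt (fun u => Real.sin ((m + 1) * u)) (Real.cos ((m + 1) * u) * (m + 1)) u := by
      simpa using ((hasDerivAt_id u).const_mul ((m : ℝ) + 1)).sin
    have : HasDerivAt G _ u :=
      ((hs.mul hL).div_const ((m : ℝ) + 1)).sub ((hS u).div_const (2 * ((m : ℝ) + 1)))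
    refine this.congr_deriv ?_
    have hid := sin_nat_mul_cos_half m u
    have hq : Real.sin ((m + 1) * u) * (Real.cos (u / 2) * (1 / 2) / Real.sin (u / 2)) =
        (1 + 2 * ∑ j ∈ Finset.range m, Real.cos ((j + 1) * u) + Real.cos ((m + 1) * u)) / 2 := by
      generalize ∑ j ∈ Finset.range m, Real.cos (((j : ℝ) + 1) * u) = A at hid
      field_simp
      linear_combination hid
    rw [hq]
    generalize ∑ j ∈ Finset.range m, Real.cos (((j : ℝ) + 1) * u) = A
    field_simp
    ring
  rw [intervalIntegral.integral_eq_sub_of_hasDerivAt_of_le Real.two_pi_pos.le hG hder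
    (intervalIntegrable_cos_mul_logKernel m _ _)]
  have hsin2 : ∀ j : ℕ, Real.sin (((j : ℝ) + 1) * (2 * Real.pi)) = 0 := fun j => by
    have := Real.sin_nat_mul_pi ((j + 1) * 2)
    push_cast at this
    rw [← this]
    ring_nf
  simp only [G, S, hsin2]
  simp
  field_simp

/-- The integrand is odd under u ↦ 2π - u. -/
theorem integral_sin_mul_logKernel (m : ℕ) :
    ∫ u in (0 : ℝ)..2 * Real.pi, Real.sin ((m + 1) * u) * logKernel u = 0 := by
  have h := intervalIntegral.integral_comp_sub_left (a := 0) (b := 2 * Real.pi)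
    (fun u => Real.sin ((m + 1) * u) * logKernel u) (2 * Real.pi)
  have hneg : ∀ u : ℝ, Real.sin ((m + 1) * (2 * Real.pi - u)) * logKernel (2 * Real.pi - u) =
      -(Real.sin ((m + 1) * u) * logKernel u) := by
    intro u
    have h1 : Real.sin ((m + 1) * (2 * Real.pi - u)) = -Real.sin ((m + 1) * u) := by
      rw [mul_sub, ← Real.sin_nat_mul_two_pi_sub ((m + 1) * u) (m + 1)]
      push_cast
      ring_nf
    have h2 : logKernel (2 * Real.pi - u) = logKernel u := by
      rw [logKernel, logKernel, show (2 * Real.pi - u) / 2 = Real.pi - u / 2 by ring,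
        Real.sin_pi_sub]
    rw [h1, h2, neg_mul]
  simp only [hneg, intervalIntegral.integral_neg, sub_self, sub_zero] at h
  linarith

theorem integral_logKernel_sub_mul {f : ℝ → ℝ} (hf : Function.Periodic f (2 * Real.pi)) (t : ℝ) :
    ∫ s in (-Real.pi)..Real.pi, logKernel (t - s) * f s =
      ∫ u in (0 : ℝ)..2 * Real.pi, logKernel u * f (t - u) := by
  have h1 := intervalIntegral.integral_comp_sub_left (a := -Real.pi) (b := Real.pi)
    (fun u => logKernel u * f (t - u)) t
  simp only [sub_sub_cancel] at h1
  have hper : Function.Periodic (fun u => logKernel u * f (t - u)) (2 * Real.pi) := by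
    intro u
    simp only [logKernel_periodic u, ← sub_sub, hf.sub_eq]
  have h2 := hper.intervalIntegral_add_eq (t - Real.pi) 0
  rw [h1, sub_neg_eq_add, ← zero_add (2 * Real.pi), ← h2]
  congr 1
  ring

theorem cos_nat_mul_periodic (m : ℕ) :
    Function.Periodic (fun s : ℝ => Real.cos ((m + 1) * s)) (2 * Real.pi) := by
  intro s
  have := Real.cos_add_nat_mul_two_pi ((m + 1) * s) (m + 1)
  push_cast at this
  simp only [mul_add, this]

theorem sin_nat_mul_periodic (m : ℕ) :
    Function.Periodic (fun s : ℝ => Real.sin ((m + 1) * s)) (2 * Real.pi) := by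
  intro s
  have := Real.sin_add_nat_mul_two_pi ((m + 1) * s) (m + 1)
  push_cast at this
  simp only [mul_add, this]

theorem integral_logKernel_sub_mul_cos (m : ℕ) (t : ℝ) :
    ∫ s in (-Real.pi)..Real.pi, logKernel (t - s) * Real.cos ((m + 1) * s) =
      -(Real.pi / (m + 1)) * Real.cos ((m + 1) * t) := by
  rw [integral_logKernel_sub_mul (cos_nat_mul_periodic m)]
  have : ∀ u : ℝ, logKernel u * Real.cos ((m + 1) * (t - u)) =
      Real.cos ((m + 1) * t) * (Real.cos ((m + 1) * u) * logKernel u) +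
        Real.sin ((m + 1) * t) * (Real.sin ((m + 1) * u) * logKernel u) := fun u => by
    rw [mul_sub, Real.cos_sub]
    ring
  simp only [this]
  rw [intervalIntegral.integral_add ((intervalIntegrable_cos_mul_logKernel m _ _).const_mul _)
    ((intervalIntegrable_sin_mul_logKernel m _ _).const_mul _), intervalIntegral.integral_const_mul,
    intervalIntegral.integral_const_mul, integral_cos_mul_logKernel, integral_sin_mul_logKernel]
  ring

theorem integral_logKernel_sub_mul_sin (m : ℕ) (t : ℝ) :
    ∫ s in (-Real.pi)..Real.pi, logKernel (t - s) * Real.sin ((m + 1) * s) =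
      -(Real.pi / (m + 1)) * Real.sin ((m + 1) * t) := by
  rw [integral_logKernel_sub_mul (sin_nat_mul_periodic m)]
  have : ∀ u : ℝ, logKernel u * Real.sin ((m + 1) * (t - u)) =
      Real.sin ((m + 1) * t) * (Real.cos ((m + 1) * u) * logKernel u) -
        Real.cos ((m + 1) * t) * (Real.sin ((m + 1) * u) * logKernel u) := fun u => by
    rw [mul_sub, Real.sin_sub]
    ring
  simp only [this]
  rw [intervalIntegral.integral_sub ((intervalIntegrable_cos_mul_logKernel m _ _).const_mul _)
    ((intervalIntegrable_sin_mul_logKernel m _ _).const_mul _), intervalIntegral.integral_const_mul,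
    intervalIntegral.integral_const_mul, integral_cos_mul_logKernel, integral_sin_mul_logKernel]
  ring

/-! ### Principal values of the cotangent over intervals -/

theorem logKernel_neg (u : ℝ) : logKernel (-u) = logKernel u := by
  rw [logKernel, logKernel, neg_div, Real.sin_neg, Real.log_neg_eq_log]

theorem hasDerivAt_logKernel {u : ℝ} (hu : Real.sin (u / 2) ≠ 0) :
    HasDerivAt logKernel (Real.cot (u / 2) / 2) u := by
  have h : HasDerivAt logKernel (Real.cos (u / 2) * (1 / 2) / Real.sin (u / 2)) u :=
    (((hasDerivAt_id u).div_const 2).sin).log hu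
  refine h.congr_deriv ?_
  rw [Real.cot_eq_cos_div_sin]
  field_simp

theorem sin_half_ne_zero {u : ℝ} (h0 : u ≠ 0) (h1 : -(2 * Real.pi) < u) (h2 : u < 2 * Real.pi) :
    Real.sin (u / 2) ≠ 0 := by
  rw [Ne, Real.sin_eq_zero_iff_of_lt_of_lt (by linarith) (by linarith)]
  intro h
  exact h0 (by linarith)

theorem integral_cot_of_notMem {a b t : ℝ} (hab : a ≤ b) (ha : -Real.pi ≤ a) (hb : b ≤ Real.pi)
    (ht : t ∈ Ioo (-Real.pi) Real.pi) (htab : t ∉ Icc a b) :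
    IntegrableOn (fun s => Real.cot ((t - s) / 2)) (Ico a b) ∧
      ∫ s in Ico a b, Real.cot ((t - s) / 2) = 2 * (logKernel (t - a) - logKernel (t - b)) := by
  have hne : ∀ s ∈ Icc a b, Real.sin ((t - s) / 2) ≠ 0 := fun s hs =>
    sin_half_ne_zero (fun h => htab ((sub_eq_zero.1 h) ▸ hs)) (by linarith [ht.1, hs.2])
      (by linarith [ht.2, hs.1])
  have hcont : ContinuousOn (fun s => Real.cot ((t - s) / 2)) (Icc a b) := by
    simp only [Real.cot_eq_cos_div_sin]
    exact ContinuousOn.div (by fun_prop) (by fun_prop) hne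
  have hder : ∀ s ∈ uIcc a b, HasDerivAt (fun s => -2 * logKernel (t - s))
      (Real.cot ((t - s) / 2)) s := by
    intro s hs
    rw [uIcc_of_le hab] at hs
    have := (((hasDerivAt_logKernel (hne s hs)).comp s
      ((hasDerivAt_id s).const_sub t)).const_mul (-2))
    refine this.congr_deriv ?_
    ring
  have hi : IntervalIntegrable (fun s => Real.cot ((t - s) / 2)) volume a b :=
    ContinuousOn.intervalIntegrable_of_Icc hab hcont
  refine ⟨(hcont.integrableOn_Icc).mono_set Ico_subset_Icc_self, ?_⟩
  rw [integral_Ico_eq_integral_Ioc, ← intervalIntegral.integral_of_le hab,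
    intervalIntegral.integral_eq_sub_of_hasDerivAt hder hi]
  ring

/-- The truncated integrals of the kernel over an interval are eventually constant. -/
theorem eventually_integral_cot {a b t : ℝ} (hab : a ≤ b) (ha : -Real.pi ≤ a) (hb : b ≤ Real.pi)
    (ht : t ∈ Ioo (-Real.pi) Real.pi) (hta : t ≠ a) (htb : t ≠ b) :
    ∀ᶠ ε in 𝓝[>] (0 : ℝ),
      IntegrableOn (fun s => Real.cot ((t - s) / 2)) (Ico a b ∩ {s | ε < |t - s|}) ∧
      ∫ s in Ico a b ∩ {s | ε < |t - s|}, Real.cot ((t - s) / 2) =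
        2 * (logKernel (t - a) - logKernel (t - b)) := by
  have hd : 0 < min |t - a| |t - b| :=
    lt_min (abs_pos.2 (sub_ne_zero.2 hta)) (abs_pos.2 (sub_ne_zero.2 htb))
  filter_upwards [Ioo_mem_nhdsGT hd] with ε hε
  obtain ⟨hε0, hεd⟩ := hε
  have hεa := hεd.trans_le (min_le_left _ _)
  have hεb := hεd.trans_le (min_le_right _ _)
  by_cases h : t ∈ Icc a b
  · obtain ⟨h1, h2⟩ := h
    rw [abs_of_nonneg (by linarith)] at hεa
    rw [abs_of_nonpos (by linarith)] at hεb
    -- The excised interval is symmetric about t and the kernel is even, so the boundary terms at t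
    -- ± ε cancel and no ε remains.
    have hset : Ico a b ∩ {s | ε < |t - s|} = Ico a (t - ε) ∪ Ioo (t + ε) b := by
      ext s
      simp only [mem_inter_iff, mem_Ico, mem_ofPred_eq, mem_union, mem_Ioo, lt_abs]
      constructor
      · rintro ⟨⟨h3, h4⟩, h5 | h5⟩
        · exact Or.inl ⟨h3, by linarith⟩
        · exact Or.inr ⟨by linarith, h4⟩
      · rintro (⟨h3, h4⟩ | ⟨h3, h4⟩)
        · exact ⟨⟨h3, by linarith⟩, Or.inl (by linarith)⟩
        · exact ⟨⟨by linarith, h4⟩, Or.inr (by linarith)⟩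
    obtain ⟨i1, e1⟩ := integral_cot_of_notMem (a := a) (b := t - ε) (by linarith) ha (by linarith) ht
      (fun h => by linarith [h.2])
    obtain ⟨i2, e2⟩ := integral_cot_of_notMem (a := t + ε) (b := b) (by linarith) (by linarith) hb ht
      (fun h => by linarith [h.1])
    have i2' := i2.mono_set Ioo_subset_Ico_self
    rw [hset]
    refine ⟨i1.union i2', ?_⟩
    rw [setIntegral_union ?_ measurableSet_Ioo i1 i2', e1, ← integral_Ico_eq_integral_Ioo, e2,
      sub_sub_cancel, sub_add_cancel_left, logKernel_neg]
    · ring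
    · rw [Set.disjoint_left]
      intro s hs hs'
      linarith [hs.2, hs'.1]
  · have hset : Ico a b ∩ {s | ε < |t - s|} = Ico a b := by
      rw [inter_eq_left]
      intro s hs
      simp only [mem_Icc, not_and_or, not_le] at h
      simp only [mem_ofPred_eq]
      rcases h with h | h
      · rw [abs_of_neg (by linarith [hs.1])]
        rw [abs_of_neg (by linarith)] at hεa
        linarith [hs.1]
      · rw [abs_of_pos (by linarith [hs.2])]
        rw [abs_of_pos (by linarith)] at hεb
        linarith [hs.2]
    rw [hset]
    exact integral_cot_of_notMem hab ha hb ht h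

/-! ### Sampling on a grid and the Hilbert transform of the samples -/

variable {X : Type*} [NormedAddCommGroup X]

/-- The nodes of the equidistant grid with `N` cells in `[-π, π]`. -/
def gridPoint (N j : ℕ) : ℝ := -Real.pi + j * (2 * Real.pi / N)

theorem gridPoint_zero (N : ℕ) : gridPoint N 0 = -Real.pi := by simp [gridPoint]

theorem gridPoint_self {N : ℕ} (hN : 0 < N) : gridPoint N N = Real.pi := by
  have : (N : ℝ) ≠ 0 := by positivity
  rw [gridPoint]
  field_simp
  ring

theorem gridPoint_succ_sub (N j : ℕ) :
    gridPoint N (j + 1) - gridPoint N j = 2 * Real.pi / N := by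
  simp only [gridPoint]
  push_cast
  ring

theorem gridPoint_mono (N : ℕ) : Monotone (gridPoint N) := by
  refine monotone_nat_of_le_succ fun j => ?_
  rw [← sub_nonneg, gridPoint_succ_sub]
  positivity

theorem neg_pi_le_gridPoint (N j : ℕ) : -Real.pi ≤ gridPoint N j := by
  rw [← gridPoint_zero N]
  exact gridPoint_mono N (Nat.zero_le j)

theorem gridPoint_le_pi {N j : ℕ} (hj : j < N) : gridPoint N (j + 1) ≤ Real.pi := by
  rw [← gridPoint_self (Nat.zero_lt_of_lt hj)]
  exact gridPoint_mono N hj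

/-- The sampling of `f` on the equidistant grid with `N` cells. -/
def gridStep (f : ℝ → X) (N : ℕ) (s : ℝ) : X :=
  ∑ j ∈ Finset.range N, (Ico (gridPoint N j) (gridPoint N (j + 1))).indicator
    (fun _ => f (gridPoint N j)) s

theorem isStep_gridStep (f : ℝ → X) (N : ℕ) : IsStep (gridStep f N) := by
  refine ⟨N, fun k => f (gridPoint N k), fun k => Ico (gridPoint N k) (gridPoint N (k + 1)),
    fun k => ⟨ordConnected_Ico, Ico_subset_Ico (neg_pi_le_gridPoint N k) (gridPoint_le_pi k.2)⟩, ?_⟩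
  ext s
  rw [gridStep, Finset.sum_range]

theorem gridStep_eq (f : ℝ → X) {N : ℕ} (hN : 0 < N) {s : ℝ} (hs : s ∈ torus) :
    ∃ r ∈ torus, |s - r| ≤ 2 * Real.pi / N ∧ gridStep f N s = f r := by
  have hN' : (0 : ℝ) < N := by exact_mod_cast hN
  have hpi := Real.pi_pos
  have hδ : 0 < 2 * Real.pi / N := by positivity
  have hnn : 0 ≤ (s + Real.pi) / (2 * Real.pi / N) := div_nonneg (by linarith [hs.1]) hδ.le
  set j := ⌊(s + Real.pi) / (2 * Real.pi / N)⌋₊ with hj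
  have h1 : (j : ℝ) * (2 * Real.pi / N) ≤ s + Real.pi := by
    rw [← le_div_iff₀ hδ]
    exact Nat.floor_le hnn
  have h2 : s + Real.pi < (j + 1) * (2 * Real.pi / N) := by
    rw [← div_lt_iff₀ hδ]
    exact Nat.lt_floor_add_one _
  have hjN : j < N := by
    rw [hj, Nat.floor_lt hnn, div_lt_iff₀ hδ]
    have := hs.2
    field_simp
    linarith
  have hmem : s ∈ Ico (gridPoint N j) (gridPoint N (j + 1)) := by
    constructor
    · rw [gridPoint]; linarith
    · rw [gridPoint]; push_cast; linarith
  refine ⟨gridPoint N j, ⟨neg_pi_le_gridPoint N j, hmem.1.trans_lt hs.2⟩, ?_, ?_⟩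
  · rw [abs_of_nonneg (by linarith [hmem.1]), ← gridPoint_succ_sub N j]
    linarith [hmem.2]
  · rw [gridStep, Finset.sum_eq_single_of_mem j (Finset.mem_range.2 hjN)]
    · simp [hmem]
    · intro i _ hij
      refine indicator_of_notMem (fun hi => ?_) _
      rcases lt_or_gt_of_ne hij with h | h
      · exact absurd (hi.2.trans_le (gridPoint_mono N h)) (not_lt.2 hmem.1)
      · exact absurd (hmem.2.trans_le (gridPoint_mono N h)) (not_lt.2 hi.1)

variable [NormedSpace ℝ X]

/-- The Hilbert transform of the sampling of `f`. -/
def gridHilbert (f : ℝ → X) (N : ℕ) (t : ℝ) : X :=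
  ∑ j ∈ Finset.range N, (1 / Real.pi *
    (logKernel (t - gridPoint N j) - logKernel (t - gridPoint N (j + 1)))) • f (gridPoint N j)

theorem stronglyMeasurable_gridHilbert (f : ℝ → X) (N : ℕ) :
    StronglyMeasurable (gridHilbert f N) := by
  have hL := measurable_logKernel
  refine Finset.stronglyMeasurable_fun_sum _ fun j _ => ?_
  refine StronglyMeasurable.smul_const (Measurable.stronglyMeasurable ?_) _
  fun_prop

/-- Summation by parts; the boundary terms cancel because the kernel is 2π-periodic and f(-π) =
f(π). The result is a Riemann–Stieltjes sum for the convolution of the kernel with f'. -/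
theorem gridHilbert_eq_sum_sub (f : ℝ → X) (hf : f (-Real.pi) = f Real.pi) {N : ℕ} (hN : 0 < N)
    (t : ℝ) : gridHilbert f N t = (1 / Real.pi) • ∑ j ∈ Finset.range N,
      logKernel (t - gridPoint N (j + 1)) • (f (gridPoint N (j + 1)) - f (gridPoint N j)) := by
  have h1 : ∀ j, (1 / Real.pi * (logKernel (t - gridPoint N j) -
      logKernel (t - gridPoint N (j + 1)))) • f (gridPoint N j) =
      (1 / Real.pi) • (logKernel (t - gridPoint N (j + 1)) •
        (f (gridPoint N (j + 1)) - f (gridPoint N j))) -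
      (1 / Real.pi) • (logKernel (t - gridPoint N (j + 1)) • f (gridPoint N (j + 1)) -
        logKernel (t - gridPoint N j) • f (gridPoint N j)) := by
    intro j
    module
  have h2 : logKernel (t - gridPoint N N) = logKernel (t - gridPoint N 0) := by
    rw [gridPoint_self hN, gridPoint_zero, sub_neg_eq_add, ← logKernel_periodic (t - Real.pi)]
    ring_nf
  rw [gridHilbert, Finset.sum_congr rfl fun j _ => h1 j, Finset.sum_sub_distrib, ← Finset.smul_sum,
    ← Finset.smul_sum, Finset.sum_range_sub (fun j => logKernel (t - gridPoint N j) •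
      f (gridPoint N j)), h2, gridPoint_self hN, gridPoint_zero, hf, sub_self, smul_zero, sub_zero]

variable [CompleteSpace X]

theorem periodicHilbert_sum_indicator {ι : Type*} (S : Finset ι) (a b : ι → ℝ) (x : ι → X)
    (hab : ∀ i ∈ S, a i ≤ b i) (ha : ∀ i ∈ S, -Real.pi ≤ a i) (hb : ∀ i ∈ S, b i ≤ Real.pi) {t : ℝ}
    (ht : t ∈ Ioo (-Real.pi) Real.pi) (hta : ∀ i ∈ S, t ≠ a i) (htb : ∀ i ∈ S, t ≠ b i) :
    periodicHilbert (fun s => ∑ i ∈ S, (Ico (a i) (b i)).indicator (fun _ => x i) s) t =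
      ∑ i ∈ S, (1 / Real.pi * (logKernel (t - a i) - logKernel (t - b i))) • x i := by
  have hev : ∀ᶠ ε in 𝓝[>] (0 : ℝ), ∀ i ∈ S,
      IntegrableOn (fun s => Real.cot ((t - s) / 2)) (Ico (a i) (b i) ∩ {s | ε < |t - s|}) ∧
      ∫ s in Ico (a i) (b i) ∩ {s | ε < |t - s|}, Real.cot ((t - s) / 2) =
        2 * (logKernel (t - a i) - logKernel (t - b i)) :=
    (Finset.eventually_all S).2 fun i hi =>
      eventually_integral_cot (hab i hi) (ha i hi) (hb i hi) ht (hta i hi) (htb i hi)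
  have hconst : ∀ᶠ ε in 𝓝[>] (0 : ℝ), truncHilbert
      (fun s => ∑ i ∈ S, (Ico (a i) (b i)).indicator (fun _ => x i) s) ε t =
        ∑ i ∈ S, (2 * (logKernel (t - a i) - logKernel (t - b i))) • x i := by
    filter_upwards [hev] with ε hε
    have hpt : ∀ s, Real.cot ((t - s) / 2) •
        ∑ i ∈ S, (Ico (a i) (b i)).indicator (fun _ => x i) s =
        ∑ i ∈ S, (Ico (a i) (b i)).indicator (fun s => Real.cot ((t - s) / 2) • x i) s := by
      intro s
      rw [Finset.smul_sum]
      refine Finset.sum_congr rfl fun i _ => ?_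
      by_cases hs : s ∈ Ico (a i) (b i) <;> simp [hs]
    have hsub : ∀ i ∈ S, Ico (a i) (b i) ∩ (torus ∩ {s | ε < |t - s|}) =
        Ico (a i) (b i) ∩ {s | ε < |t - s|} := by
      intro i hi
      have : Ico (a i) (b i) ⊆ torus := Ico_subset_Ico (ha i hi) (hb i hi)
      rw [← inter_assoc, inter_eq_left.2 this]
    rw [truncHilbert]
    simp only [hpt]
    rw [integral_finsetSum]
    · refine Finset.sum_congr rfl fun i hi => ?_
      rw [integral_indicator measurableSet_Ico, Measure.restrict_restrict measurableSet_Ico,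
        hsub i hi, integral_smul_const, (hε i hi).2]
    · intro i hi
      rw [integrable_indicator_iff measurableSet_Ico, IntegrableOn,
        Measure.restrict_restrict measurableSet_Ico, hsub i hi]
      exact (hε i hi).1.smul_const (x i)
  have hlim : Tendsto (fun ε => truncHilbert
      (fun s => ∑ i ∈ S, (Ico (a i) (b i)).indicator (fun _ => x i) s) ε t) (𝓝[>] (0 : ℝ))
      (𝓝 (∑ i ∈ S, (2 * (logKernel (t - a i) - logKernel (t - b i))) • x i)) :=
    tendsto_const_nhds.congr' (hconst.mono fun _ h => h.symm)
  rw [periodicHilbert, hlim.limUnder_eq, Finset.smul_sum]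
  refine Finset.sum_congr rfl fun i _ => ?_
  rw [smul_smul]
  congr 1
  field_simp

theorem periodicHilbert_gridStep (f : ℝ → X) (N : ℕ) :
    ∀ᵐ t ∂volume.restrict torus, periodicHilbert (gridStep f N) t = gridHilbert f N t := by
  have hnull : ∀ᵐ t : ℝ, t ∉ (insert (-Real.pi) ((Finset.range (N + 1)).image (gridPoint N)) :
      Finset ℝ) :=
    measure_eq_zero_iff_ae_notMem.1 (Finset.measure_zero _ _)
  filter_upwards [ae_restrict_of_ae hnull, ae_restrict_mem measurableSet_Ico] with t ht htm
  have hne : ∀ j < N + 1, t ≠ gridPoint N j := fun j hj h => ht (Finset.mem_insert_of_mem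
    (Finset.mem_image.2 ⟨j, Finset.mem_range.2 hj, h.symm⟩))
  have ht' : t ∈ Ioo (-Real.pi) Real.pi :=
    ⟨lt_of_le_of_ne htm.1 fun h => ht (h ▸ Finset.mem_insert_self _ _), htm.2⟩
  exact periodicHilbert_sum_indicator (Finset.range N) (gridPoint N) (fun j => gridPoint N (j + 1))
    (fun j => f (gridPoint N j)) (fun j _ => gridPoint_mono N (Nat.le_succ j))
    (fun j _ => neg_pi_le_gridPoint N j) (fun j hj => gridPoint_le_pi (Finset.mem_range.1 hj)) ht'
    (fun j hj => hne j (by have := Finset.mem_range.1 hj; omega))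
    (fun j hj => hne (j + 1) (by have := Finset.mem_range.1 hj; omega))

/-- The Hilbert transforms of the samplings of a smooth function converge in `L¹`. -/
theorem tendsto_lintegral_gridHilbert_sub {f g h : ℝ → X} (hfg : ∀ s, HasDerivAt f (g s) s)
    (hg : Continuous g) (hf : f (-Real.pi) = f Real.pi)
    (hh : ∀ t, h t = (1 / Real.pi) • ∫ s in (-Real.pi)..Real.pi, logKernel (t - s) • g s) :
    Tendsto (fun N : ℕ => ∫⁻ t in Ioc (-Real.pi) Real.pi, ‖gridHilbert f (N + 1) t - h t‖ₑ) atTop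
      (𝓝 0) := by
  obtain ⟨K, hK⟩ := (isCompact_Icc (a := -Real.pi) (b := Real.pi)).exists_bound_of_continuousOn
    hg.continuousOn
  have hKL : ∀ t a b : ℝ, IntervalIntegrable (fun s => logKernel (t - s) • g s) volume a b := by
    intro t a b
    refine IntervalIntegrable.smul_continuousOn ?_ hg.continuousOn
    simpa using (intervalIntegrable_logKernel (t - a) (t - b)).comp_sub_left t
  have hpt : ∀ (N : ℕ) (t : ℝ), ‖gridHilbert f (N + 1) t - h t‖ₑ ≤
      ∑ j ∈ Finset.range (N + 1), ∫⁻ s in Ioc (gridPoint (N + 1) j) (gridPoint (N + 1) (j + 1)),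
        ‖logKernel (t - gridPoint (N + 1) (j + 1)) - logKernel (t - s)‖ₑ * ENNReal.ofReal K := by
    intro N t
    have hsplit : ∫ s in (-Real.pi)..Real.pi, logKernel (t - s) • g s =
        ∑ j ∈ Finset.range (N + 1), ∫ s in gridPoint (N + 1) j..gridPoint (N + 1) (j + 1),
          logKernel (t - s) • g s := by
      rw [intervalIntegral.sum_integral_adjacent_intervals (fun j _ => hKL t _ _), gridPoint_zero,
        gridPoint_self (Nat.succ_pos N)]
    have hincr : ∀ j, f (gridPoint (N + 1) (j + 1)) - f (gridPoint (N + 1) j) =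
        ∫ s in gridPoint (N + 1) j..gridPoint (N + 1) (j + 1), g s := fun j =>
      (intervalIntegral.integral_eq_sub_of_hasDerivAt (fun s _ => hfg s)
        (hg.intervalIntegrable _ _)).symm
    -- On each cell the error is the integral of (L(t - node) - L(t - s)) g(s), where L is the
    -- kernel.
    rw [gridHilbert_eq_sum_sub f hf (Nat.succ_pos N), hh, hsplit, ← smul_sub,
      ← Finset.sum_sub_distrib, enorm_smul]
    have hpi : ‖(1 / Real.pi : ℝ)‖ₑ ≤ 1 := by
      rw [Real.enorm_eq_ofReal (by positivity), ENNReal.ofReal_le_one, div_le_one Real.pi_pos]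
      linarith [Real.pi_gt_three]
    refine (mul_le_mul_left hpi _).trans ?_
    rw [one_mul]
    refine (enorm_sum_le _ _).trans (Finset.sum_le_sum fun j hj => ?_)
    have hmono := gridPoint_mono (N + 1) (Nat.le_succ j)
    have hi : IntervalIntegrable
        (fun s => logKernel (t - gridPoint (N + 1) (j + 1)) • g s) volume
        (gridPoint (N + 1) j) (gridPoint (N + 1) (j + 1)) :=
      (hg.intervalIntegrable _ _).smul _
    rw [hincr j, ← intervalIntegral.integral_smul, ← intervalIntegral.integral_sub hi (hKL t _ _),
      intervalIntegral.integral_of_le hmono]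
    refine (enorm_integral_le_lintegral_enorm _).trans ?_
    refine setLIntegral_mono' measurableSet_Ioc fun s hs => ?_
    rw [← sub_smul, enorm_smul]
    gcongr
    rw [← ofReal_norm]
    exact ENNReal.ofReal_le_ofReal (hK s ⟨(neg_pi_le_gridPoint _ j).trans hs.1.le,
      hs.2.trans (gridPoint_le_pi (Finset.mem_range.1 hj))⟩)
  rw [ENNReal.tendsto_nhds_zero]
  intro ε hε
  obtain ⟨η, hη, hηε⟩ : ∃ η : ℝ≥0∞, 0 < η ∧
      η * ENNReal.ofReal (2 * Real.pi) * ENNReal.ofReal K ≤ ε := by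
    -- The added 1 avoids division by zero when `ENNReal.ofReal K` vanishes.
    refine ⟨ε / (ENNReal.ofReal (2 * Real.pi) * ENNReal.ofReal K + 1),
      ENNReal.div_pos hε.ne' (by finiteness), ?_⟩
    rw [mul_assoc]
    refine (mul_le_mul_right le_self_add _).trans_eq (ENNReal.div_mul_cancel ?_ (by finiteness))
    positivity
  obtain ⟨δ, hδ, hδη⟩ := exists_delta_lintegral_logKernel_sub_le hη
  have hev : ∀ᶠ N : ℕ in atTop, 2 * Real.pi / ((N + 1 : ℕ) : ℝ) < δ := by
    have := (tendsto_const_div_atTop_nhds_zero_nat (2 * Real.pi)).comp (tendsto_add_atTop_nat 1)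
    exact this.eventually (gt_mem_nhds hδ)
  filter_upwards [hev] with N hN
  have hm : ∀ j, Measurable (fun q : ℝ × ℝ =>
      ‖logKernel (q.1 - gridPoint (N + 1) (j + 1)) - logKernel (q.1 - q.2)‖ₑ * ENNReal.ofReal K) := by
    intro j
    have := measurable_logKernel
    fun_prop
  calc ∫⁻ t in Ioc (-Real.pi) Real.pi, ‖gridHilbert f (N + 1) t - h t‖ₑ
      ≤ ∫⁻ t in Ioc (-Real.pi) Real.pi, ∑ j ∈ Finset.range (N + 1),
        ∫⁻ s in Ioc (gridPoint (N + 1) j) (gridPoint (N + 1) (j + 1)),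
        ‖logKernel (t - gridPoint (N + 1) (j + 1)) - logKernel (t - s)‖ₑ * ENNReal.ofReal K :=
        lintegral_mono fun t => hpt N t
    -- Tonelli: integrating in t first leaves the L¹ distance of two translates of the kernel by
    -- nearby points, at most η.
    _ = ∑ j ∈ Finset.range (N + 1), ∫⁻ s in Ioc (gridPoint (N + 1) j) (gridPoint (N + 1) (j + 1)),
        ∫⁻ t in Ioc (-Real.pi) Real.pi,
        ‖logKernel (t - gridPoint (N + 1) (j + 1)) - logKernel (t - s)‖ₑ * ENNReal.ofReal K := by
        rw [lintegral_finsetSum _ fun j _ => (hm j).lintegral_prod_right]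
        exact Finset.sum_congr rfl fun j _ => lintegral_lintegral_swap (hm j).aemeasurable
    _ ≤ ∑ j ∈ Finset.range (N + 1), ∫⁻ _ in
        Ioc (gridPoint (N + 1) j) (gridPoint (N + 1) (j + 1)), η * ENNReal.ofReal K := by
        refine Finset.sum_le_sum fun j _ => setLIntegral_mono' measurableSet_Ioc fun s hs => ?_
        rw [lintegral_mul_const' _ _ ENNReal.ofReal_ne_top]
        gcongr
        refine hδη _ _ (lt_of_le_of_lt ?_ hN)
        rw [abs_of_nonneg (by linarith [hs.2]), ← gridPoint_succ_sub (N + 1) j]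
        linarith [hs.1]
    _ = η * ENNReal.ofReal (2 * Real.pi) * ENNReal.ofReal K := by
        simp only [setLIntegral_const, Real.volume_Ioc, gridPoint_succ_sub, Finset.sum_const,
          Finset.card_range, nsmul_eq_mul]
        have : ((N + 1 : ℕ) : ℝ≥0∞) * ENNReal.ofReal (2 * Real.pi / ((N + 1 : ℕ) : ℝ)) =
            ENNReal.ofReal (2 * Real.pi) := by
          rw [← ENNReal.ofReal_natCast, ← ENNReal.ofReal_mul (by positivity)]
          congr 1
          field_simp
        rw [← this]
        ring
    _ ≤ ε := hηε

/-! ### The complexification as a topological complex vector space -/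

/-- The complexification `X + iX` of a real vector space, as a complex vector space. -/
def Complexified (X : Type*) : Type _ := X × X

namespace Complexified

variable {X : Type*}

/-- The element `x + iy`. -/
def mk (x y : X) : Complexified X := (x, y)

/-- The real part. -/
def re (p : Complexified X) : X := Prod.fst p

/-- The imaginary part. -/
def im (p : Complexified X) : X := Prod.snd p

theorem re_mk (x y : X) : (mk x y).re = x := rfl

theorem im_mk (x y : X) : (mk x y).im = y := rfl

variable [NormedAddCommGroup X]

instance : AddCommGroup (Complexified X) := inferInstanceAs (AddCommGroup (X × X))

instance : TopologicalSpace (Complexified X) := inferInstanceAs (TopologicalSpace (X × X))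

instance : IsTopologicalAddGroup (Complexified X) := inferInstanceAs (IsTopologicalAddGroup (X × X))

theorem add_re (p q : Complexified X) : (p + q).re = p.re + q.re := rfl

theorem add_im (p q : Complexified X) : (p + q).im = p.im + q.im := rfl

theorem zero_re : (0 : Complexified X).re = 0 := rfl

theorem zero_im : (0 : Complexified X).im = 0 := rfl

theorem continuous_re : Continuous (re : Complexified X → X) :=
  _root_.continuous_fst (X := X) (Y := X)

theorem continuous_im : Continuous (im : Complexified X → X) :=
  _root_.continuous_snd (X := X) (Y := X)

variable [NormedSpace ℝ X]

/-- The action is `complexSMul` by definition, so results about complex lines here transfer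
definitionally to `Plurisubharmonic` on `X × X`. -/
instance : Module ℂ (Complexified X) where
  smul z v := complexSMul z v
  one_smul v := by
    change complexSMul 1 (v : X × X) = (v : X × X)
    ext <;> simp [complexSMul]
  mul_smul z w v := by
    change complexSMul (z * w) v = complexSMul z (complexSMul w v)
    simp only [complexSMul, Complex.mul_re, Complex.mul_im]
    ext <;> module
  smul_zero z := by
    change complexSMul z (0 : X × X) = 0
    simp [complexSMul]
  smul_add z v w := by
    change (z.re • (v.re + w.re) - z.im • (v.im + w.im), z.re • (v.im + w.im) + z.im • (v.re + w.re))
      = ((z.re • v.re - z.im • v.im) + (z.re • w.re - z.im • w.im),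
        (z.re • v.im + z.im • v.re) + (z.re • w.im + z.im • w.re))
    ext <;> module
  add_smul z w v := by
    change ((z + w).re • v.re - (z + w).im • v.im, (z + w).re • v.im + (z + w).im • v.re)
      = ((z.re • v.re - z.im • v.im) + (w.re • v.re - w.im • v.im),
        (z.re • v.im + z.im • v.re) + (w.re • v.im + w.im • v.re))
    simp only [Complex.add_re, Complex.add_im]
    ext <;> module
  zero_smul v := by
    change complexSMul 0 v = (0 : X × X)
    simp [complexSMul]

theorem smul_re (z : ℂ) (v : Complexified X) : (z • v).re = z.re • v.re - z.im • v.im := rfl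

theorem smul_im (z : ℂ) (v : Complexified X) : (z • v).im = z.re • v.im + z.im • v.re := rfl

instance : ContinuousSMul ℂ (Complexified X) where
  continuous_smul := by
    change Continuous fun q : ℂ × X × X =>
      ((q.1.re • q.2.1 - q.1.im • q.2.2, q.1.re • q.2.2 + q.1.im • q.2.1) : X × X)
    have := Complex.continuous_re
    have := Complex.continuous_im
    fun_prop

end Complexified

/-! ### Boundary values of analytic discs as conjugate pairs -/

section Conjugate

variable {X : Type*} [NormedAddCommGroup X] [NormedSpace ℝ X]

theorem fourier_coe_re (k : ℕ) (s : ℝ) :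
    (fourier (((k + 1 : ℕ)) : ℤ) (s : Circ) : ℂ).re = Real.cos ((k + 1) * s) ∧
    (fourier (((k + 1 : ℕ)) : ℤ) (s : Circ) : ℂ).im = Real.sin ((k + 1) * s) := by
  have h : (fourier (((k + 1 : ℕ)) : ℤ) (s : Circ) : ℂ) =
      Complex.exp ((((k + 1) * s : ℝ) : ℂ) * Complex.I) := by
    rw [fourier_coe_apply]
    congr 1
    push_cast
    field_simp
  rw [h]
  exact ⟨Complex.exp_ofReal_mul_I_re _, Complex.exp_ofReal_mul_I_im _⟩

variable [CompleteSpace X]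

/-- On the boundary of an analytic disc the imaginary part is the conjugate of the real part. -/
theorem exists_deriv_conjugate {F : Circ → Complexified X} (hF : F ∈ analyticPoly (Complexified X)) :
    ∃ g : ℝ → X, Continuous g ∧ (∀ s : ℝ, HasDerivAt (fun s : ℝ => (F s).re) (g s) s) ∧
      ∀ t : ℝ, (F t).im = (1 / Real.pi) • ∫ s in (-Real.pi)..Real.pi, logKernel (t - s) • g s := by
  -- The span is complex while the claim is only real-linear: a complex scalar mixes real and
  -- imaginary parts. Quantifying over c makes the induction close under scalars.
  suffices h : ∀ c : ℂ, ∃ g : ℝ → X, Continuous g ∧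
      (∀ s : ℝ, HasDerivAt (fun s : ℝ => (c • F s).re) (g s) s) ∧
      ∀ t : ℝ, (c • F t).im =
        (1 / Real.pi) • ∫ s in (-Real.pi)..Real.pi, logKernel (t - s) • g s by
    simpa using h 1
  have hint : ∀ (t : ℝ) {g : ℝ → ℝ}, Continuous g →
      IntervalIntegrable (fun s => logKernel (t - s) * g s) volume (-Real.pi) Real.pi := by
    intro t g hg
    refine IntervalIntegrable.mul_continuousOn ?_ hg.continuousOn
    simpa using (intervalIntegrable_logKernel (t - -Real.pi) (t - Real.pi)).comp_sub_left t
  have hintX : ∀ (t : ℝ) {g : ℝ → X}, Continuous g →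
      IntervalIntegrable (fun s => logKernel (t - s) • g s) volume (-Real.pi) Real.pi := by
    intro t g hg
    refine IntervalIntegrable.smul_continuousOn ?_ hg.continuousOn
    simpa using (intervalIntegrable_logKernel (t - -Real.pi) (t - Real.pi)).comp_sub_left t
  induction hF using Submodule.span_induction with
  | mem F h =>
    obtain ⟨k, hk, v, rfl⟩ := h
    obtain ⟨m, rfl⟩ : ∃ m, k = m + 1 := ⟨k - 1, by omega⟩
    intro c
    have hm : ((m : ℝ) + 1) ≠ 0 := by positivity
    have e1 : ∀ s : ℝ, (c • (fourier ((m + 1 : ℕ) : ℤ) (s : Circ) • v)).re =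
        Real.cos ((m + 1) * s) • (c • v).re - Real.sin ((m + 1) * s) • (c • v).im := by
      intro s
      rw [smul_comm, Complexified.smul_re, (fourier_coe_re m s).1, (fourier_coe_re m s).2]
    have e2 : ∀ s : ℝ, (c • (fourier ((m + 1 : ℕ) : ℤ) (s : Circ) • v)).im =
        Real.cos ((m + 1) * s) • (c • v).im + Real.sin ((m + 1) * s) • (c • v).re := by
      intro s
      rw [smul_comm, Complexified.smul_im, (fourier_coe_re m s).1, (fourier_coe_re m s).2]
    set w := c • v
    refine ⟨fun s => (-Real.sin ((m + 1) * s) * (m + 1)) • w.re -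
      (Real.cos ((m + 1) * s) * (m + 1)) • w.im, by fun_prop, fun s => ?_, fun t => ?_⟩
    · simp only [e1]
      have hl : HasDerivAt (fun s : ℝ => ((m : ℝ) + 1) * s) (m + 1) s := by
        simpa using (hasDerivAt_id s).const_mul ((m : ℝ) + 1)
      exact (hl.cos.smul_const _).sub (hl.sin.smul_const _)
    · have hsplit : ∀ s : ℝ, logKernel (t - s) • ((-Real.sin ((m + 1) * s) * (m + 1)) • w.re -
          (Real.cos ((m + 1) * s) * (m + 1)) • w.im) =
          (logKernel (t - s) * Real.sin ((m + 1) * s)) • (-((m : ℝ) + 1) • w.re) -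
          (logKernel (t - s) * Real.cos ((m + 1) * s)) • (((m : ℝ) + 1) • w.im) := by
        intro s
        module
      simp only [hsplit]
      have i1 : IntervalIntegrable (fun s : ℝ =>
          (logKernel (t - s) * Real.sin ((m + 1) * s)) • (-((m : ℝ) + 1) • w.re)) volume
          (-Real.pi) Real.pi := by
        have := hint t (g := fun s => Real.sin ((m + 1) * s)) (by fun_prop)
        exact ⟨this.1.smul_const _, this.2.smul_const _⟩
      have i2 : IntervalIntegrable (fun s : ℝ =>
          (logKernel (t - s) * Real.cos ((m + 1) * s)) • (((m : ℝ) + 1) • w.im)) volume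
          (-Real.pi) Real.pi := by
        have := hint t (g := fun s => Real.cos ((m + 1) * s)) (by fun_prop)
        exact ⟨this.1.smul_const _, this.2.smul_const _⟩
      rw [intervalIntegral.integral_sub i1 i2, intervalIntegral.integral_smul_const,
        intervalIntegral.integral_smul_const, integral_logKernel_sub_mul_sin,
        integral_logKernel_sub_mul_cos, e2]
      have hpi := Real.pi_ne_zero
      match_scalars <;> field_simp
  | zero =>
    intro c
    refine ⟨0, continuous_zero, fun s => ?_, fun t => ?_⟩
    · simpa [Complexified.zero_re] using hasDerivAt_const s (0 : X)
    · simp [Complexified.zero_im]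
  | add F G _ _ hF hG =>
    intro c
    obtain ⟨g, hg, hd, hi⟩ := hF c
    obtain ⟨g', hg', hd', hi'⟩ := hG c
    refine ⟨fun s => g s + g' s, hg.add hg', fun s => ?_, fun t => ?_⟩
    · simp only [Pi.add_apply, smul_add, Complexified.add_re]
      exact (hd s).add (hd' s)
    · simp only [Pi.add_apply, smul_add, Complexified.add_im, hi t, hi' t]
      rw [intervalIntegral.integral_add (hintX t hg) (hintX t hg'), smul_add]
  | smul a F _ hF =>
    intro c
    simpa only [Pi.smul_apply, smul_smul] using hF (c * a)

end Conjugate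

/-! ### The Φ,Ψ-inequality for smooth functions and their conjugates -/

section Inequality

variable {X : Type*} [NormedAddCommGroup X]

theorem tendsto_gridStep {f : ℝ → X} (hf : Continuous f) {s : ℝ} (hs : s ∈ torus) :
    Tendsto (fun N : ℕ => gridStep f (N + 1) s) atTop (𝓝 (f s)) := by
  choose r _ hr hfr using fun N : ℕ => gridStep_eq f (Nat.succ_pos N) hs
  have hlim : Tendsto r atTop (𝓝 s) := by
    rw [tendsto_iff_dist_tendsto_zero]
    refine squeeze_zero (fun _ => dist_nonneg) (g := fun N : ℕ => 2 * Real.pi / ((N + 1 : ℕ) : ℝ))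
      (fun N => ?_)
      ((tendsto_const_div_atTop_nhds_zero_nat (2 * Real.pi)).comp (tendsto_add_atTop_nat 1))
    rw [dist_comm, Real.dist_eq]
    exact hr N
  simpa only [Nat.succ_eq_add_one, hfr, Function.comp_def] using (hf.tendsto s).comp hlim

theorem stronglyMeasurable_gridStep (f : ℝ → X) (N : ℕ) : StronglyMeasurable (gridStep f N) :=
  Finset.stronglyMeasurable_fun_sum _ fun _ _ =>
    stronglyMeasurable_const.indicator measurableSet_Ico

theorem tendsto_lintegral_gridStep {Φ : X → ℝ} (hΦ : Continuous Φ) {f : ℝ → X} (hf : Continuous f) :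
    (∀ N : ℕ, ∫⁻ s in torus, ENNReal.ofReal (Φ (gridStep f (N + 1) s)) ≠ ⊤) ∧
    Tendsto (fun N : ℕ => ∫⁻ s in torus, ENNReal.ofReal (Φ (gridStep f (N + 1) s))) atTop
      (𝓝 (∫⁻ s in torus, ENNReal.ofReal (Φ (f s)))) := by
  obtain ⟨M, hM⟩ := (isCompact_Icc (a := -Real.pi) (b := Real.pi)).exists_bound_of_continuousOn
    (hΦ.comp hf).continuousOn
  have hvol : volume torus ≠ ⊤ := by
    rw [torus, Real.volume_Ico]
    exact ENNReal.ofReal_ne_top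
  have hbound : ∀ N : ℕ, ∀ᵐ s ∂volume.restrict torus,
      ENNReal.ofReal (Φ (gridStep f (N + 1) s)) ≤ ENNReal.ofReal M := by
    intro N
    filter_upwards [ae_restrict_mem measurableSet_Ico] with s hs
    obtain ⟨r, hr, -, hfr⟩ := gridStep_eq f (Nat.succ_pos N) hs
    rw [hfr]
    exact ENNReal.ofReal_le_ofReal ((le_abs_self _).trans (hM r (Ico_subset_Icc_self hr)))
  have hconst : ∫⁻ _ in torus, ENNReal.ofReal M ≠ ⊤ := by
    rw [setLIntegral_const]
    exact ENNReal.mul_ne_top ENNReal.ofReal_ne_top hvol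
  refine ⟨fun N => ne_top_of_le_ne_top hconst (lintegral_mono_ae (hbound N)), ?_⟩
  refine tendsto_lintegral_of_dominated_convergence _ (fun N => ?_) hbound hconst ?_
  · exact ((hΦ.comp_stronglyMeasurable (stronglyMeasurable_gridStep f (N + 1))).measurable).ennreal_ofReal
  · filter_upwards [ae_restrict_mem measurableSet_Ico] with s hs
    exact ENNReal.tendsto_ofReal ((hΦ.tendsto _).comp (tendsto_gridStep hf hs))

variable [NormedSpace ℝ X]

/-- The infimum is itself admissible: divide by the integral of Φ(f) when it is finite and nonzero.
If it is zero, any admissible constant already gives the bound. -/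
theorem lintegral_periodicHilbert_le {Φ Ψ : X → ℝ} (hfin : hilbertNorm Φ Ψ < ⊤) {f : ℝ → X}
    (hf : IsStep f) (hΦf : ∫⁻ s in torus, ENNReal.ofReal (Φ (f s)) ≠ ⊤) :
    ∫⁻ s in torus, ENNReal.ofReal (Ψ (periodicHilbert f s)) ≤
      hilbertNorm Φ Ψ * ∫⁻ s in torus, ENNReal.ofReal (Φ (f s)) := by
  obtain ⟨c, hc, -⟩ := sInf_lt_iff.1 hfin
  rcases eq_or_ne (∫⁻ s in torus, ENNReal.ofReal (Φ (f s))) 0 with h0 | h0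
  · have := hc f hf
    rwa [h0, mul_zero] at this ⊢
  · rw [← ENNReal.div_le_iff_le_mul (.inl h0) (.inl hΦf)]
    refine le_sInf fun c hc => ?_
    rw [ENNReal.div_le_iff_le_mul (.inl h0) (.inl hΦf)]
    exact hc f hf

variable [CompleteSpace X]

/-- The inequality for step functions passes to smooth functions and their conjugates. -/
theorem lintegral_conjugate_le {Φ Ψ : X → ℝ} (hΦ : Continuous Φ) (hΨ : Continuous Ψ)
    (hfin : hilbertNorm Φ Ψ < ⊤) {f g h : ℝ → X} (hfg : ∀ s, HasDerivAt f (g s) s)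
    (hg : Continuous g) (hf : f (-Real.pi) = f Real.pi) (hhc : Continuous h)
    (hh : ∀ t, h t = (1 / Real.pi) • ∫ s in (-Real.pi)..Real.pi, logKernel (t - s) • g s) :
    ∫⁻ s in torus, ENNReal.ofReal (Ψ (h s)) ≤
      hilbertNorm Φ Ψ * ∫⁻ s in torus, ENNReal.ofReal (Φ (f s)) := by
  have hfc : Continuous f := continuous_iff_continuousAt.2 fun s => (hfg s).continuousAt
  have hrestr : volume.restrict torus = volume.restrict (Ioc (-Real.pi) Real.pi) :=
    Measure.restrict_congr_set Ico_ae_eq_Ioc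
  have hmeas : TendstoInMeasure (volume.restrict torus) (fun N : ℕ => gridHilbert f (N + 1)) atTop
      h := by
    refine tendstoInMeasure_of_tendsto_eLpNorm one_ne_zero
      (fun N => (stronglyMeasurable_gridHilbert f _).aestronglyMeasurable)
      hhc.aestronglyMeasurable ?_
    simp only [eLpNorm_one_eq_lintegral_enorm, hrestr, Pi.sub_apply]
    exact tendsto_lintegral_gridHilbert_sub hfg hg hf hh
  obtain ⟨ns, hns, hae⟩ := hmeas.exists_seq_tendsto_ae
  obtain ⟨htop, hlim⟩ := tendsto_lintegral_gridStep hΦ hfc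
  have hlim' := ENNReal.Tendsto.const_mul (a := hilbertNorm Φ Ψ) (hlim.comp hns.tendsto_atTop)
    (Or.inr hfin.ne)
  have hbound : ∀ k, ∫⁻ s in torus, ENNReal.ofReal (Ψ (gridHilbert f (ns k + 1) s)) ≤
      hilbertNorm Φ Ψ * ∫⁻ s in torus, ENNReal.ofReal (Φ (gridStep f (ns k + 1) s)) := by
    intro k
    refine le_trans (le_of_eq (lintegral_congr_ae ?_))
      (lintegral_periodicHilbert_le hfin (isStep_gridStep f (ns k + 1)) (htop (ns k)))
    filter_upwards [periodicHilbert_gridStep f (ns k + 1)] with s hs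
    rw [hs]
  -- Along an a.e. convergent subsequence, Fatou handles the left side, where `Ψ` has no growth
  -- control, and the right side converges by dominated convergence.
  calc ∫⁻ s in torus, ENNReal.ofReal (Ψ (h s))
      = ∫⁻ s in torus, liminf (fun k => ENNReal.ofReal (Ψ (gridHilbert f (ns k + 1) s))) atTop := by
        refine lintegral_congr_ae ?_
        filter_upwards [hae] with s hs
        exact (ENNReal.tendsto_ofReal ((hΨ.tendsto _).comp hs)).liminf_eq.symm
    _ ≤ liminf (fun k => ∫⁻ s in torus, ENNReal.ofReal (Ψ (gridHilbert f (ns k + 1) s))) atTop :=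
        lintegral_liminf_le fun k => ((hΨ.comp_stronglyMeasurable
          (stronglyMeasurable_gridHilbert f _)).measurable).ennreal_ofReal
    _ ≤ liminf (fun k => hilbertNorm Φ Ψ *
          ∫⁻ s in torus, ENNReal.ofReal (Φ (gridStep f (ns k + 1) s))) atTop :=
        liminf_le_liminf (Eventually.of_forall hbound)
    _ = _ := hlim'.liminf_eq

end Inequality

/-! ### Disc means of the obstacle: positivity over real centres, concavity in y -/

section Main

variable {X : Type*} [NormedAddCommGroup X]

/-- The function `x + iy ↦ c Φ(x) - Ψ(y)` on the complexification. -/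
def obstacle (Φ Ψ : X → ℝ) (c : ℝ) (p : Complexified X) : ℝ := c * Φ p.re - Ψ p.im

theorem continuous_obstacle {Φ Ψ : X → ℝ} (hΦ : Continuous Φ) (hΨ : Continuous Ψ) (c : ℝ) :
    Continuous (obstacle Φ Ψ c) :=
  (continuous_const.mul (hΦ.comp Complexified.continuous_re)).sub
    (hΨ.comp Complexified.continuous_im)

variable [NormedSpace ℝ X]

/-- The imaginary part of F is the conjugate of f = x + Re F, as the constant x does not change f'.
Up to the factor 1/(2π), the mean is the difference of the two sides of the inequality for f. -/
theorem discMean_obstacle_nonneg [CompleteSpace X] {Φ Ψ : X → ℝ} (hΦ : Continuous Φ)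
    (hΨ : Continuous Ψ) (hΦ_nonneg : ∀ x, 0 ≤ Φ x) (hΨ_nonneg : ∀ x, 0 ≤ Ψ x)
    (hfin : hilbertNorm Φ Ψ < ⊤) {F : Circ → Complexified X}
    (hF : F ∈ analyticPoly (Complexified X)) (x : X) :
    0 ≤ discMean (obstacle Φ Ψ (hilbertNorm Φ Ψ).toReal) F (.mk x 0) := by
  have hFc := continuous_of_mem_analyticPoly hF
  obtain ⟨g, hg, hd, hi⟩ := exists_deriv_conjugate hF
  have hmk : Continuous fun s : ℝ => F (s : Circ) := hFc.comp (AddCircle.continuous_mk' _)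
  have hfc : Continuous fun s : ℝ => x + (F s).re :=
    continuous_const.add (Complexified.continuous_re.comp hmk)
  have hhc : Continuous fun s : ℝ => (F s).im := Complexified.continuous_im.comp hmk
  have hper : ((-Real.pi : ℝ) : Circ) = (Real.pi : ℝ) := by
    rw [← AddCircle.coe_add_period (2 * Real.pi) (-Real.pi)]
    congr 1
    ring
  have key := lintegral_conjugate_le hΦ hΨ hfin (f := fun s : ℝ => x + (F s).re)
    (fun s => (hd s).const_add x) hg (by simp only [hper]) hhc hi
  have hrestr : volume.restrict torus = volume.restrict (Ioc (-Real.pi) Real.pi) :=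
    Measure.restrict_congr_set Ico_ae_eq_Ioc
  have hint : ∀ {φ : ℝ → ℝ}, Continuous φ → IntegrableOn φ (Ioc (-Real.pi) Real.pi) := fun hφ =>
    (hφ.continuousOn.integrableOn_Icc).mono_set Ioc_subset_Icc_self
  have i1 : IntegrableOn (fun s : ℝ => Φ (x + (F s).re)) (Ioc (-Real.pi) Real.pi) :=
    hint (hΦ.comp hfc)
  have i2 : IntegrableOn (fun s : ℝ => Ψ (F s).im) (Ioc (-Real.pi) Real.pi) :=
    hint (hΨ.comp hhc)
  rw [hrestr, ← ofReal_integral_eq_lintegral_ofReal i1 (Eventually.of_forall fun _ => hΦ_nonneg _),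
    ← ofReal_integral_eq_lintegral_ofReal i2 (Eventually.of_forall fun _ => hΨ_nonneg _),
    ← ENNReal.ofReal_toReal hfin.ne, ← ENNReal.ofReal_mul ENNReal.toReal_nonneg,
    ENNReal.ofReal_le_ofReal_iff (mul_nonneg ENNReal.toReal_nonneg
      (integral_nonneg fun _ => hΦ_nonneg _))] at key
  have h1 := AddCircle.integral_preimage (2 * Real.pi) (-Real.pi)
    (fun θ => obstacle Φ Ψ (hilbertNorm Φ Ψ).toReal (Complexified.mk x 0 + F θ))
  rw [show -Real.pi + 2 * Real.pi = Real.pi by ring] at h1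
  have h2 : ∀ s : ℝ, obstacle Φ Ψ (hilbertNorm Φ Ψ).toReal (Complexified.mk x 0 + F s) =
      (hilbertNorm Φ Ψ).toReal * Φ (x + (F s).re) - Ψ (F s).im := fun s => by
    rw [obstacle, Complexified.add_re, Complexified.add_im, Complexified.re_mk,
      Complexified.im_mk, zero_add]
  rw [discMean, AddCircle.integral_haarAddCircle, ← h1]
  simp only [h2]
  rw [integral_sub (i1.const_mul _) i2, integral_const_mul]
  exact smul_nonneg (inv_nonneg.2 Real.two_pi_pos.le) (sub_nonneg.2 key)

/-- For a fixed disc, y enters only through -Ψ(y + Im F(θ)), which is concave for every θ. -/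
theorem discMean_obstacle_concave {Φ Ψ : X → ℝ} (hΦ : Continuous Φ) (hΨ : Continuous Ψ)
    (hconv : ConvexOn ℝ univ Ψ) (c : ℝ) {F : Circ → Complexified X}
    (hF : F ∈ analyticPoly (Complexified X)) (x : X) :
    ConcaveOn ℝ univ fun y : X => discMean (obstacle Φ Ψ c) F (.mk x y) := by
  have hFc := continuous_of_mem_analyticPoly hF
  have hV := continuous_obstacle hΦ hΨ c
  refine ⟨convex_univ, fun y _ z _ a b ha hb hab => ?_⟩
  have hint : ∀ p : Complexified X, Integrable (fun θ => obstacle Φ Ψ c (p + F θ)) circMeasure :=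
    fun p => (hV.comp (continuous_const.add hFc)).integrable_of_hasCompactSupport
      (HasCompactSupport.of_compactSpace _)
  simp only [discMean, smul_eq_mul]
  rw [← integral_const_mul, ← integral_const_mul,
    ← integral_add ((hint _).const_mul _) ((hint _).const_mul _)]
  refine integral_mono (((hint _).const_mul _).add ((hint _).const_mul _)) (hint _) fun θ => ?_
  simp only [obstacle, Complexified.add_re, Complexified.add_im, Complexified.re_mk,
    Complexified.im_mk]
  have h := hconv.2 (mem_univ (y + (F θ).im)) (mem_univ (z + (F θ).im)) ha hb hab
  have he : a • (y + (F θ).im) + b • (z + (F θ).im) = a • y + b • z + (F θ).im := by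
    rw [smul_add, smul_add, add_add_add_comm, ← add_smul, hab, one_smul]
  rw [he] at h
  simp only [smul_eq_mul] at h
  linear_combination h + c * Φ (x + (F θ).re) * hab

end Main

/-! ### The envelope along complex lines -/

section ComplexLines

variable {E : Type*} [AddCommGroup E] [Module ℂ E] [TopologicalSpace E] [IsTopologicalAddGroup E]
  [ContinuousSMul ℂ E]

theorem subMean_discEnvelope_line {V : E → ℝ} (hV : Continuous V) (p v : E) :
    SubMean fun z : ℂ => discEnvelope V (p + z • v) := by
  intro z r g hg hle
  refine discEnvelope_le_integral hV (p + z • v) ((r : ℂ) • v) hg fun θ => ?_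
  convert hle θ using 2
  rw [add_smul, smul_smul, add_assoc, mul_comm]

theorem upperSemicontinuous_discEnvelope_line {V : E → ℝ} (hV : Continuous V) (p v : E) :
    UpperSemicontinuous fun z : ℂ => discEnvelope V (p + z • v) :=
  (upperSemicontinuous_discEnvelope hV).comp (by fun_prop)

end ComplexLines

/-! ### Finiteness and concavity of the envelope for convex Ψ -/

section Finite

variable {X : Type*} [NormedAddCommGroup X] [NormedSpace ℝ X] {Φ Ψ : X → ℝ}

theorem concaveOn_toReal_discEnvelope (hΦ : Continuous Φ) (hΨ : Continuous Ψ)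
    (hconv : ConvexOn ℝ univ Ψ) (C : ℝ)
    (hbot : ∀ x y : X, discEnvelope (obstacle Φ Ψ C) (.mk x y) ≠ ⊥) (x : X) :
    ConcaveOn ℝ univ fun y : X => (discEnvelope (obstacle Φ Ψ C) (.mk x y)).toReal := by
  have hcoe : ∀ y, (((discEnvelope (obstacle Φ Ψ C) (.mk x y)).toReal : ℝ) : EReal) =
      discEnvelope (obstacle Φ Ψ C) (.mk x y) := fun y =>
    EReal.coe_toReal (discEnvelope_ne_top _ _) (hbot x y)
  refine ⟨convex_univ, fun y _ z _ a b ha hb hab => ?_⟩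
  rw [← EReal.coe_le_coe_iff, hcoe]
  refine le_iInf fun F => EReal.coe_le_coe_iff.2 ?_
  have hle : ∀ y, (discEnvelope (obstacle Φ Ψ C) (.mk x y)).toReal ≤
      discMean (obstacle Φ Ψ C) F (.mk x y) := fun y => by
    rw [← EReal.coe_le_coe_iff, hcoe]
    exact discEnvelope_le_discMean _ F.2 _
  refine le_trans ?_ ((discMean_obstacle_concave hΦ hΨ hconv C F.2 x).2
    (mem_univ y) (mem_univ z) ha hb hab)
  simp only [smul_eq_mul]
  exact add_le_add (mul_le_mul_of_nonneg_left (hle y) ha) (mul_le_mul_of_nonneg_left (hle z) hb)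

variable [CompleteSpace X]

theorem discEnvelope_obstacle_nonneg (hΦ : Continuous Φ) (hΨ : Continuous Ψ)
    (hΦ_nonneg : ∀ x, 0 ≤ Φ x) (hΨ_nonneg : ∀ x, 0 ≤ Ψ x) (hfin : hilbertNorm Φ Ψ < ⊤) (x : X) :
    0 ≤ discEnvelope (obstacle Φ Ψ (hilbertNorm Φ Ψ).toReal) (.mk x 0) :=
  le_iInf fun F => EReal.coe_nonneg.2
    (discMean_obstacle_nonneg hΦ hΨ hΦ_nonneg hΨ_nonneg hfin F.2 x)

/-- On the line z ↦ x + zy the envelope is nonnegative for real z, so it is finite at some x + ity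
with t ≥ 1. Concavity of each disc mean between 0 and ty then bounds it below at y, uniformly over
all discs. -/
theorem discEnvelope_obstacle_ne_bot (hΦ : Continuous Φ) (hΨ : Continuous Ψ)
    (hΦ_nonneg : ∀ x, 0 ≤ Φ x) (hΨ_nonneg : ∀ x, 0 ≤ Ψ x) (hfin : hilbertNorm Φ Ψ < ⊤)
    (hconv : ConvexOn ℝ univ Ψ) (x y : X) :
    discEnvelope (obstacle Φ Ψ (hilbertNorm Φ Ψ).toReal) (.mk x y) ≠ ⊥ := by
  have hV := continuous_obstacle hΦ hΨ (hilbertNorm Φ Ψ).toReal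
  have hline : ∀ z : ℂ, Complexified.mk x 0 + z • Complexified.mk y 0 =
      .mk (x + z.re • y) (z.im • y) := fun z => by
    change (Complexified.mk (x + (z.re • y - z.im • (0 : X))) (0 + (z.re • (0 : X) + z.im • y))) = _
    simp
  obtain ⟨z, hre, him, hz⟩ := (subMean_discEnvelope_line hV (.mk x 0) (.mk y 0)).ne_bot
    (upperSemicontinuous_discEnvelope_line hV _ _)
    (V := fun z => obstacle Φ Ψ (hilbertNorm Φ Ψ).toReal (.mk x 0 + z • .mk y 0))
    (hV.comp (by fun_prop)) (fun z => discEnvelope_le _ _) fun s => by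
      rw [hline, Complex.ofReal_im, zero_smul]
      exact ((EReal.bot_lt_coe 0).trans_le (discEnvelope_obstacle_nonneg hΦ hΨ hΦ_nonneg hΨ_nonneg hfin _)).ne'
  rw [hline, hre, zero_smul, add_zero] at hz
  set t := z.im
  have ht : 0 < t := one_pos.trans_le him
  set c := (discEnvelope (obstacle Φ Ψ (hilbertNorm Φ Ψ).toReal) (.mk x (t • y))).toReal with hc
  have hcE : (c : EReal) = discEnvelope (obstacle Φ Ψ (hilbertNorm Φ Ψ).toReal) (.mk x (t • y)) :=
    EReal.coe_toReal (discEnvelope_ne_top _ _) hz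
  -- Here y = (1 - 1/t)·0 + (1/t)·(ty); the mean at 0 is nonnegative and the mean at ty is at least
  -- c.
  have hle : ((t⁻¹ * c : ℝ) : EReal) ≤
      discEnvelope (obstacle Φ Ψ (hilbertNorm Φ Ψ).toReal) (.mk x y) := by
    refine le_iInf fun F => EReal.coe_le_coe_iff.2 ?_
    have h1 := (discMean_obstacle_concave hΦ hΨ hconv (hilbertNorm Φ Ψ).toReal F.2 x).2
      (mem_univ 0) (mem_univ (t • y)) (sub_nonneg.2 (inv_le_one_of_one_le₀ him))
      (inv_nonneg.2 ht.le) (sub_add_cancel 1 t⁻¹)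
    rw [smul_zero, zero_add, smul_smul, inv_mul_cancel₀ ht.ne', one_smul, smul_eq_mul,
      smul_eq_mul] at h1
    have h2 : c ≤ discMean (obstacle Φ Ψ (hilbertNorm Φ Ψ).toReal) F (.mk x (t • y)) := by
      rw [← EReal.coe_le_coe_iff, hcE]
      exact discEnvelope_le_discMean _ F.2 _
    have h3 := mul_nonneg (sub_nonneg.2 (inv_le_one_of_one_le₀ him))
      (discMean_obstacle_nonneg hΦ hΨ hΦ_nonneg hΨ_nonneg hfin F.2 x)
    have h4 := mul_le_mul_of_nonneg_left h2 (inv_nonneg.2 ht.le)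
    linarith
  exact ((EReal.bot_lt_coe _).trans_le hle).ne'

end Finite

theorem plurisubharmonic_discEnvelope {X : Type*} [NormedAddCommGroup X] [NormedSpace ℝ X]
    {V : Complexified X → ℝ} (hV : Continuous V) :
    Plurisubharmonic fun p : X × X => discEnvelope V (.mk p.1 p.2) := by
  have hline : ∀ p v : Complexified X, Subharmonic fun z : ℂ => discEnvelope V (p + z • v) :=
    fun p v => (subMean_discEnvelope_line hV p v).subharmonic
      (upperSemicontinuous_discEnvelope_line hV p v) fun _ => discEnvelope_ne_top _ _
  have husc : UpperSemicontinuous (discEnvelope V) := upperSemicontinuous_discEnvelope hV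
  exact ⟨fun _ => discEnvelope_ne_top _ _, husc, hline⟩

end

end HilbertPSH

theorem mainTheorem9 {X : Type*} [NormedAddCommGroup X] [NormedSpace ℝ X] [CompleteSpace X]
    [TopologicalSpace.SeparableSpace X] (Φ Ψ : X → ℝ)
    (hΦ : Continuous Φ) (hΨ : Continuous Ψ)
    (hΦ_nonneg : ∀ x, 0 ≤ Φ x) (hΨ_nonneg : ∀ x, 0 ≤ Ψ x) (hΨ_zero : Ψ 0 = 0)
    (hfin : HilbertPSH.hilbertNorm Φ Ψ < ⊤) :
    ∃ U : X × X → EReal,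
      HilbertPSH.Plurisubharmonic U ∧
      (∀ x : X, 0 ≤ U (x, 0)) ∧
      (∀ x y : X,
        U (x, y) ≤ (((HilbertPSH.hilbertNorm Φ Ψ).toReal * Φ x - Ψ y : ℝ) : EReal)) ∧
      (ConvexOn ℝ Set.univ Ψ →
        (∀ p : X × X, U p ≠ ⊥) ∧
        ∀ x : X, ConcaveOn ℝ Set.univ (fun y : X => (U (x, y)).toReal)) := by
  have hV := HilbertPSH.continuous_obstacle hΦ hΨ (HilbertPSH.hilbertNorm Φ Ψ).toReal
  refine ⟨fun p => HilbertPSH.discEnvelope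
    (HilbertPSH.obstacle Φ Ψ (HilbertPSH.hilbertNorm Φ Ψ).toReal) (.mk p.1 p.2),
    HilbertPSH.plurisubharmonic_discEnvelope hV,
    HilbertPSH.discEnvelope_obstacle_nonneg hΦ hΨ hΦ_nonneg hΨ_nonneg hfin,
    fun x y => HilbertPSH.discEnvelope_le _ _, fun hconv => ?_⟩
  have hbot :=
    HilbertPSH.discEnvelope_obstacle_ne_bot hΦ hΨ hΦ_nonneg hΨ_nonneg hfin hconv
  exact ⟨fun p => hbot p.1 p.2,
    HilbertPSH.concaveOn_toReal_discEnvelope hΦ hΨ hconv _ hbot⟩
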